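/- Let $K$ be a field of characteristic $0$, complete with respect to a nontrivial non-archimedean norm. All series below are formal power series in one variable over $K$; such a series is called (locally) analytic if its radius of convergence at $0$ is positive, and $f$ is tangent to the identity if $f(x)=x+O(x^2)$. For $f$ tangent to the identity write $$Z_F(f)=\{g\in K[[x]] : g(x)=x+O(x^2),\ g\circ f=f\circ g\},\qquad Z_A(f)=\{g\in Z_F(f) : g \text{ analytic}\}$$ for its formal and its analytic centralizer. Say that $f$ has invariants $m\ge 2$ and $\mu\in K$ if there is a formal power series $H$ over $K$ with $H(0)=0$, $H'(0)\ne 0$ and $H\circ f\circ H^{-1}(x)=x+x^m+\mu x^{2m-1}$. For a formal vector field $V(x)\frac{\partial}{\partial x}$ with $V(x)=O(x^2)$, its formal flow is the unique series $T_V^t(x)=\sum_{n\ge1}a_n(t)x^n$ with $a_n\in K[t]$ such that $T_V^0(x)=x$ and $\frac{d}{dt}T_V^t(x)=V(T_V^t(x))$. **Corollary (centralizers).** Let $f$ be analytic and tangent to the identity, with invariants $m$ and $\mu$, and let $$V=\frac{x^m}{1-\left(\mu-\frac m2\right)x^{m-1}}\,\frac{\partial}{\partial x}.$$ Then there is an analytic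 $h$ with $h(0)=0$, $h'(0)\neq0$ and $h\circ f\circ h^{-1}=T_V^1$; if the coefficient of $x^m$ in $f$ is $1$, then $h$ can be chosen tangent to the identity. Moreover, for every analytic $h$ with $h(0)=0$, $h'(0)\ne0$ and $h\circ f\circ h^{-1}=T_V^1$, $$Z_A(f)=\{h^{-1}\circ T_V^t\circ h : t\in K\}\qquad\text{and}\qquad Z_F(f)=Z_A(f).$$ -/

import Mathlib

open PowerSeries

namespace NonArchGerm

/-! ### Power series fixing the origin: composition, inversion, conjugation, convergence -/

section Basic

variable {K : Type*} [Field K]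

/-- Composition `f ∘ g` of formal power series (meaningful when `g` has no constant term). -/
noncomputable def comp (f g : K⟦X⟧) : K⟦X⟧ := f.subst g

/-- The compositional inverse of `h = a x + O(x ^ 2)` with `a ≠ 0`. -/
noncomputable def compInv (h : K⟦X⟧) (h1 : coeff 1 h ≠ 0) : K⟦X⟧ :=
  h.substInvOfIsUnit h1.isUnit

theorem comp_compInv (h : K⟦X⟧) (h0 : constantCoeff h = 0) (h1 : coeff 1 h ≠ 0) :
    comp h (compInv h h1) = X :=
  h.subst_substInvOfIsUnit_right h0 h1.isUnit

theorem compInv_comp (h : K⟦X⟧) (h0 : constantCoeff h = 0) (h1 : coeff 1 h ≠ 0) :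
    comp (compInv h h1) h = X :=
  h.subst_substInvOfIsUnit_left h0 h1.isUnit

/-- The conjugate `h ∘ f ∘ h⁻¹`. -/
noncomputable def conj (h : K⟦X⟧) (h1 : coeff 1 h ≠ 0) (f : K⟦X⟧) : K⟦X⟧ :=
  comp h (comp f (compInv h h1))

/-- `f(x) = x + O(x ^ 2)`. -/
def TangentToId (f : K⟦X⟧) : Prop :=
  constantCoeff f = 0 ∧ coeff 1 f = 1

/-- `f` has formal invariants `m` and `μ`: it is formally conjugate to
`x + x ^ m + μ x ^ (2 m - 1)`, where `2 ≤ m`. -/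
def HasInvariants (f : K⟦X⟧) (m : ℕ) (μ : K) : Prop :=
  2 ≤ m ∧ ∃ (H : K⟦X⟧) (H1 : coeff 1 H ≠ 0), constantCoeff H = 0 ∧
    conj H H1 f = X + X ^ m + C μ * X ^ (2 * m - 1)

/-- The formal centralizer of `f`, in the group of formal series tangent to the identity. -/
def formalCentralizer (f : K⟦X⟧) : Set K⟦X⟧ :=
  {g | TangentToId g ∧ comp g f = comp f g}

end Basic

/-- `f = ∑ aₙ xⁿ` is locally analytic at `0`: its radius of convergence is positive. -/
def IsLocallyAnalytic {K : Type*} [NontriviallyNormedField K] (f : K⟦X⟧) : Prop :=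
  0 < (FormalMultilinearSeries.ofScalars K (fun n => coeff n f)).radius

/-- The analytic centralizer of `f`, in the group of locally analytic series tangent to the
identity. -/
def analyticCentralizer {K : Type*} [NontriviallyNormedField K] (f : K⟦X⟧) : Set K⟦X⟧ :=
  {g | IsLocallyAnalytic g ∧ TangentToId g ∧ comp g f = comp f g}

/-! ### The formal flow of a vector field `V(x) ∂/∂x` with `V = O(x ^ 2)`

A vector field is given by its coefficient series `V`. Its flow is a series
`T = ∑ aₙ(t) xⁿ` whose coefficients are polynomials in the time `t`. -/

section Flow

variable {K : Type*} [Field K]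

/-- Differentiation with respect to the time, coefficient by coefficient. -/
noncomputable def timeDeriv (T : (Polynomial K)⟦X⟧) : (Polynomial K)⟦X⟧ :=
  PowerSeries.mk fun n => Polynomial.derivative (coeff n T)

/-- `T` is the formal flow of `V ∂/∂x`: it has no constant term, it is the identity at time `0`,
and `dT/dt = V(T)`. -/
def IsFormalFlow (V : K⟦X⟧) (T : (Polynomial K)⟦X⟧) : Prop :=
  constantCoeff T = 0 ∧ PowerSeries.map (Polynomial.evalRingHom 0) T = X ∧
    timeDeriv T = V.subst T

/-- The antiderivative of a polynomial that vanishes at `0`. -/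
noncomputable def antideriv (p : Polynomial K) : Polynomial K :=
  p.sum fun n a => Polynomial.monomial (n + 1) (a / ((n : K) + 1))

/-- The Picard operator `T ↦ x + ∫₀ᵗ V(T) dt`. -/
noncomputable def picard (V : K⟦X⟧) (T : (Polynomial K)⟦X⟧) : (Polynomial K)⟦X⟧ :=
  X + PowerSeries.mk fun n => antideriv (coeff n (V.subst T : (Polynomial K)⟦X⟧))

/-- The formal flow of `V ∂/∂x`, by formal antidifferentiation: the coefficient of `xⁿ` is stable
from the `n`-th Picard iterate on. See `isFormalFlow_flow` and `IsFormalFlow.eq_flow`. -/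
noncomputable def flow (V : K⟦X⟧) : (Polynomial K)⟦X⟧ :=
  PowerSeries.mk fun n => coeff n ((picard V)^[n] X)

/-- The time-`t` map of the formal flow of `V ∂/∂x`. -/
noncomputable def timeMap (V : K⟦X⟧) (t : K) : K⟦X⟧ :=
  PowerSeries.map (Polynomial.evalRingHom t) (flow V)

theorem hasSubst_of_dvd {T : (Polynomial K)⟦X⟧} (hT : X ∣ T) : HasSubst T :=
  HasSubst.of_constantCoeff_zero' (X_dvd_iff.mp hT)

theorem dvd_subst_sub {V : K⟦X⟧} (hV : X ^ 2 ∣ V) {S T : (Polynomial K)⟦X⟧} (hS : X ∣ S)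
    (hT : X ∣ T) {n : ℕ} (h : X ^ n ∣ S - T) :
    X ^ (n + 1) ∣ (V.subst S : (Polynomial K)⟦X⟧) - V.subst T := by
  rw [X_pow_dvd_iff]
  intro i hi
  rw [map_sub, coeff_subst' (hasSubst_of_dvd hS), coeff_subst' (hasSubst_of_dvd hT), sub_eq_zero]
  refine finsum_congr fun d => ?_
  by_cases hd : d < 2
  · rw [X_pow_dvd_iff.mp hV d hd, zero_smul, zero_smul]
  · have key : X ^ (n + 1) ∣ S ^ d - T ^ d := by
      rw [pow_succ, ← (Commute.all S T).mul_geom_sum₂ d]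
      refine mul_dvd_mul h (Finset.dvd_sum fun j hj => ?_)
      rw [Finset.mem_range] at hj
      by_cases hj0 : j = 0
      · exact Dvd.dvd.mul_left (dvd_pow hT (by omega)) _
      · exact Dvd.dvd.mul_right (dvd_pow hS hj0) _
    have := X_pow_dvd_iff.mp key i hi
    rw [map_sub, sub_eq_zero] at this
    rw [this]

theorem antideriv_zero : antideriv (0 : Polynomial K) = 0 := by
  simp [antideriv]

theorem eval_antideriv (p : Polynomial K) : (antideriv p).eval 0 = 0 := by
  simp [antideriv, Polynomial.sum, Polynomial.eval_finsetSum]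

theorem derivative_antideriv [CharZero K] (p : Polynomial K) :
    Polynomial.derivative (antideriv p) = p := by
  have h : ∀ n : ℕ, (n : K) + 1 ≠ 0 := fun n => by exact_mod_cast n.succ_ne_zero
  conv_rhs => rw [p.as_sum_support]
  simp [antideriv, Polynomial.sum, h]

theorem eq_of_derivative_eq [CharZero K] {p q : Polynomial K}
    (h : Polynomial.derivative p = Polynomial.derivative q) (h0 : p.eval 0 = q.eval 0) : p = q := by
  have hd : Polynomial.derivative (p - q) = 0 := by simp [h]
  have hc := Polynomial.eq_C_of_derivative_eq_zero hd
  rw [Polynomial.coeff_zero_eq_eval_zero, Polynomial.eval_sub, h0, sub_self, map_zero] at hc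
  exact sub_eq_zero.mp hc

theorem dvd_picard {V : K⟦X⟧} (hV : X ^ 2 ∣ V) {T : (Polynomial K)⟦X⟧} (hT : X ∣ T) :
    X ∣ picard V T := by
  have h := dvd_subst_sub hV hT (dvd_zero X) (n := 0) (by simp)
  have h0 : (V.subst (0 : (Polynomial K)⟦X⟧) : (Polynomial K)⟦X⟧) = 0 :=
    subst_zero_of_constantCoeff_zero (X_dvd_iff.mp ((dvd_pow_self X two_ne_zero).trans hV))
  rw [h0, sub_zero, zero_add, pow_one, X_dvd_iff] at h
  rw [picard, X_dvd_iff]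
  rw [← coeff_zero_eq_constantCoeff_apply] at h ⊢
  rw [map_add, coeff_mk, h, antideriv_zero, coeff_zero_X, add_zero]

theorem dvd_picard_sub {V : K⟦X⟧} (hV : X ^ 2 ∣ V) {S T : (Polynomial K)⟦X⟧} (hS : X ∣ S)
    (hT : X ∣ T) {n : ℕ} (h : X ^ n ∣ S - T) : X ^ (n + 1) ∣ picard V S - picard V T := by
  have h' := dvd_subst_sub hV hS hT h
  rw [X_pow_dvd_iff] at h' ⊢
  intro i hi
  have := h' i hi
  rw [map_sub, sub_eq_zero] at this
  simp [picard, this]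

theorem dvd_iterate_picard {V : K⟦X⟧} (hV : X ^ 2 ∣ V) (n : ℕ) : X ∣ (picard V)^[n] X := by
  induction n with
  | zero => simp
  | succ n ih => rw [Function.iterate_succ_apply']; exact dvd_picard hV ih

theorem dvd_iterate_sub {V : K⟦X⟧} (hV : X ^ 2 ∣ V) {T : (Polynomial K)⟦X⟧} (hT : X ∣ T) (n : ℕ) :
    X ^ (n + 1) ∣ (picard V)^[n] T - (picard V)^[n] X := by
  have hd : ∀ k, X ∣ (picard V)^[k] T := fun k => by
    induction k with
    | zero => simpa
    | succ k ih => rw [Function.iterate_succ_apply']; exact dvd_picard hV ih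
  induction n with
  | zero => simpa using dvd_sub hT dvd_rfl
  | succ n ih =>
    rw [Function.iterate_succ_apply', Function.iterate_succ_apply']
    exact dvd_picard_sub hV (hd n) (dvd_iterate_picard hV n) ih

theorem dvd_flow_sub {V : K⟦X⟧} (hV : X ^ 2 ∣ V) (n : ℕ) :
    X ^ (n + 1) ∣ flow V - (picard V)^[n] X := by
  rw [X_pow_dvd_iff]
  intro i hi
  obtain ⟨k, rfl⟩ : ∃ k, n = i + k := ⟨n - i, by omega⟩
  have := X_pow_dvd_iff.mp (dvd_iterate_sub hV (dvd_iterate_picard hV k) i) i (Nat.lt_succ_self i)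
  rw [map_sub, sub_eq_zero] at this
  rw [Function.iterate_add_apply, map_sub, this]
  simp [flow]

theorem dvd_flow {V : K⟦X⟧} (hV : X ^ 2 ∣ V) : X ∣ flow V := by
  have h := dvd_flow_sub hV 0
  rw [zero_add, pow_one] at h
  exact (dvd_sub_left (dvd_iterate_picard hV 0)).mp h

theorem picard_flow {V : K⟦X⟧} (hV : X ^ 2 ∣ V) : picard V (flow V) = flow V := by
  ext1 n
  have h1 := dvd_picard_sub hV (dvd_flow hV) (dvd_iterate_picard hV n) (dvd_flow_sub hV n)
  rw [← Function.iterate_succ_apply' (picard V)] at h1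
  have h := X_pow_dvd_iff.mp (dvd_sub h1 (dvd_flow_sub hV (n + 1))) n (by omega)
  simpa [sub_eq_zero] using h

theorem isFormalFlow_iff [CharZero K] {V : K⟦X⟧} {T : (Polynomial K)⟦X⟧} :
    IsFormalFlow V T ↔ X ∣ T ∧ picard V T = T := by
  rw [IsFormalFlow, X_dvd_iff]
  refine and_congr_right fun _ => ⟨fun ⟨h0, h⟩ => ?_, fun h => ⟨?_, ?_⟩⟩
  · ext1 n
    refine eq_of_derivative_eq ?_ ?_
    · have := congrArg (coeff n) h
      simp only [timeDeriv, coeff_mk] at this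
      rw [this]
      by_cases hn : n = 1 <;> simp [picard, derivative_antideriv, coeff_X, hn]
    · have := congrArg (coeff n) h0
      simp only [coeff_map, Polynomial.coe_evalRingHom] at this
      rw [this]
      by_cases hn : n = 1 <;> simp [picard, eval_antideriv, coeff_X, hn]
  · ext n
    conv_lhs => rw [← h]
    by_cases hn : n = 1 <;> simp [picard, eval_antideriv, coeff_X, hn]
  · ext1 n
    conv_lhs => rw [← h]
    by_cases hn : n = 1 <;> simp [timeDeriv, picard, derivative_antideriv, coeff_X, hn]

/-- The formal flow exists. -/
theorem isFormalFlow_flow [CharZero K] {V : K⟦X⟧} (hV : X ^ 2 ∣ V) : IsFormalFlow V (flow V) :=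
  isFormalFlow_iff.mpr ⟨dvd_flow hV, picard_flow hV⟩

/-- The formal flow is unique. -/
theorem IsFormalFlow.eq_flow [CharZero K] {V : K⟦X⟧} (hV : X ^ 2 ∣ V) {T : (Polynomial K)⟦X⟧}
    (hT : IsFormalFlow V T) : T = flow V := by
  obtain ⟨hd, hp⟩ := isFormalFlow_iff.mp hT
  ext1 n
  have h := dvd_iterate_sub hV hd n
  rw [Function.iterate_fixed hp] at h
  have := X_pow_dvd_iff.mp (dvd_sub h (dvd_flow_sub hV n)) n (Nat.lt_succ_self n)
  simpa [sub_eq_zero] using this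

/-- The coefficient of the vector field `x ^ m / (1 - (μ - m / 2) x ^ (m - 1)) ∂/∂x`. -/
noncomputable def modelField (m : ℕ) (μ : K) : K⟦X⟧ :=
  X ^ m * (1 - C (μ - (m : K) / 2) * X ^ (m - 1))⁻¹

theorem X_sq_dvd_modelField {m : ℕ} (hm : 2 ≤ m) (μ : K) : X ^ 2 ∣ modelField m μ :=
  Dvd.dvd.mul_right (pow_dvd_pow X hm) _

end Flow

end NonArchGerm

/-!
Let `f = x + α x ^ (q + 1) + ⋯` and `g` be tangent to the identity and let `h ∘ f = g ∘ h`. Once `h`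
is known below degree `n`, the coefficient of degree `n + q` in this equation is affine in the
`n`-th coefficient of `h`, with slope `(n - q - 1) α`, so that `n = q + 1` is the only resonance.
Hence `h` is determined by its coefficients of degrees `1` and `q + 1`, and the flow of `V` realizes
every value of the resonant coefficient in the centralizer of its time-one map. The divisors
`n - q - 1` accumulate to a factorial, and in an ultrametric field of characteristic zero `1 / n!`
grows only geometrically. Therefore every formal conjugacy between analytic germs converges; the
elements of `Z_F(f)` are the conjugacies from `f` to itself.
-/

namespace NonArchGerm

section Congruences

variable {R A : Type*} [CommRing R] [CommRing A] [Algebra R A]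

theorem X_pow_succ_dvd_iff {p : A⟦X⟧} {n : ℕ} :
    X ^ (n + 1) ∣ p ↔ X ^ n ∣ p ∧ coeff n p = 0 := by
  simp only [X_pow_dvd_iff, Nat.forall_lt_succ_right]

theorem coeff_eq_of_X_pow_dvd_sub {p q : A⟦X⟧} {n k : ℕ} (h : X ^ n ∣ p - q) (hk : k < n) :
    coeff k p = coeff k q := by
  rw [← sub_eq_zero, ← map_sub]
  exact X_pow_dvd_iff.mp h k hk

theorem eq_of_forall_X_pow_dvd_sub {p q : A⟦X⟧} (h : ∀ n, X ^ n ∣ p - q) : p = q := by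
  ext n
  exact coeff_eq_of_X_pow_dvd_sub (h (n + 1)) n.lt_succ_self

theorem X_pow_dvd_sub_of_le {a : ℕ → A⟦X⟧} (h : ∀ n, X ^ n ∣ a (n + 1) - a n) {k n : ℕ}
    (hkn : k ≤ n) : X ^ k ∣ a n - a k := by
  induction n, hkn using Nat.le_induction with
  | base => simp
  | succ n hkn ih =>
    rw [← sub_add_sub_cancel _ (a n)]
    exact dvd_add ((pow_dvd_pow X hkn).trans (h n)) ih

theorem exists_forall_X_pow_dvd_sub {P : ℕ → A⟦X⟧ → Prop} (h0 : ∃ u, P 0 u)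
    (step : ∀ n u, P n u → ∃ v, X ^ n ∣ v - u ∧ P (n + 1) v) :
    ∃ u, ∀ n, ∃ v, P n v ∧ X ^ n ∣ u - v := by
  obtain ⟨u₀, hu₀⟩ := h0
  choose! next hnext hP using step
  let a : ℕ → A⟦X⟧ := fun n => Nat.rec u₀ next n
  have ha : ∀ n, P n (a n) := fun n => by
    induction n with
    | zero => exact hu₀
    | succ n ih => exact hP n _ ih
  refine ⟨PowerSeries.mk fun n => coeff n (a (n + 1)), fun n => ⟨a n, ha n, ?_⟩⟩
  rw [X_pow_dvd_iff]
  intro i hi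
  rw [map_sub, coeff_mk, sub_eq_zero]
  exact (coeff_eq_of_X_pow_dvd_sub
    (X_pow_dvd_sub_of_le (fun k => hnext k _ (ha k)) hi) i.lt_succ_self).symm

theorem coeff_add_mul_of_X_pow_dvd {p r : A⟦X⟧} {n j : ℕ} (hp : X ^ n ∣ p) (hr : X ^ j ∣ r) :
    coeff (n + j) (p * r) = coeff n p * coeff j r := by
  obtain ⟨p, rfl⟩ := hp
  obtain ⟨r, rfl⟩ := hr
  have hcoeff (k : ℕ) (s : A⟦X⟧) : coeff k (X ^ k * s) = constantCoeff s := by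
    simpa using coeff_X_pow_mul s k 0
  rw [mul_mul_mul_comm, ← pow_add, hcoeff, hcoeff, hcoeff, map_mul]

theorem coeff_X_mul_pow (w : A⟦X⟧) {d n : ℕ} (hd : d ≤ n) :
    coeff n ((X * w) ^ d) = coeff (n - d) (w ^ d) := by
  rw [mul_pow, coeff_X_pow_mul', if_pos hd]

theorem coeff_self_pow_of_X_dvd {S : A⟦X⟧} (hS : X ∣ S) (j : ℕ) :
    coeff j (S ^ j) = coeff 1 S ^ j := by
  obtain ⟨w, rfl⟩ := hS
  rw [coeff_X_mul_pow w le_rfl, Nat.sub_self, coeff_zero_eq_constantCoeff_apply, map_pow,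
    ← zero_add 1, coeff_succ_X_mul, coeff_zero_eq_constantCoeff_apply]

theorem X_pow_dvd_pow_mul_pow {S T : A⟦X⟧} (hS : X ∣ S) (hT : X ∣ T) {i j : ℕ} (hij : i ≤ j) :
    X ^ j ∣ S ^ i * T ^ (j - i) := by
  have h := mul_dvd_mul (pow_dvd_pow_of_dvd hS i) (pow_dvd_pow_of_dvd hT (j - i))
  rwa [← pow_add, Nat.add_sub_cancel' hij] at h

theorem pow_succ_sub_pow_succ (S T : A) (j : ℕ) :
    S ^ (j + 1) - T ^ (j + 1) = (S - T) * ∑ i ∈ Finset.range (j + 1), S ^ i * T ^ (j - i) := by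
  simpa using ((Commute.all S T).mul_geom_sum₂ (j + 1)).symm

theorem X_pow_dvd_geom_sum₂ {S T : A⟦X⟧} (hS : X ∣ S) (hT : X ∣ T) (j : ℕ) :
    X ^ j ∣ ∑ i ∈ Finset.range (j + 1), S ^ i * T ^ (j - i) :=
  Finset.dvd_sum fun _ hi =>
    X_pow_dvd_pow_mul_pow hS hT (Nat.lt_succ_iff.mp (Finset.mem_range.mp hi))

theorem X_pow_dvd_pow_sub_pow {S T : A⟦X⟧} (hS : X ∣ S) (hT : X ∣ T) {n : ℕ}
    (h : X ^ n ∣ S - T) (j : ℕ) : X ^ (n + j) ∣ S ^ (j + 1) - T ^ (j + 1) := by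
  rw [pow_succ_sub_pow_succ, pow_add]
  exact mul_dvd_mul h (X_pow_dvd_geom_sum₂ hS hT j)

theorem coeff_pow_sub_pow {S T : A⟦X⟧} {a : A} (hS : X ∣ S) (hS1 : coeff 1 S = a) (hT : X ∣ T)
    (hT1 : coeff 1 T = a) {n : ℕ} (h : X ^ n ∣ S - T) (j : ℕ) :
    coeff (n + j) (S ^ (j + 1) - T ^ (j + 1)) = (j + 1) * a ^ j * coeff n (S - T) := by
  have hterm : ∀ i ∈ Finset.range (j + 1), coeff j (S ^ i * T ^ (j - i)) = a ^ j := by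
    intro i hi
    obtain ⟨k, rfl⟩ := Nat.exists_eq_add_of_le (Nat.lt_succ_iff.mp (Finset.mem_range.mp hi))
    rw [Nat.add_sub_cancel_left, coeff_add_mul_of_X_pow_dvd (pow_dvd_pow_of_dvd hS i)
      (pow_dvd_pow_of_dvd hT k), coeff_self_pow_of_X_dvd hS, coeff_self_pow_of_X_dvd hT, hS1, hT1,
      pow_add]
  rw [pow_succ_sub_pow_succ, coeff_add_mul_of_X_pow_dvd h (X_pow_dvd_geom_sum₂ hS hT j), map_sum,
    Finset.sum_congr rfl hterm, Finset.sum_const, Finset.card_range, nsmul_eq_mul]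
  push_cast
  ring

theorem hasSubst_of_X_dvd {T : A⟦X⟧} (hT : X ∣ T) : HasSubst T :=
  HasSubst.of_constantCoeff_zero' (X_dvd_iff.mp hT)

theorem coeff_subst_eq_sum (V : R⟦X⟧) {T : A⟦X⟧} (hT : X ∣ T) {n N : ℕ} (hn : n < N) :
    coeff n (V.subst T : A⟦X⟧) = ∑ d ∈ Finset.range N, coeff d V • coeff n (T ^ d) := by
  rw [coeff_subst' (hasSubst_of_X_dvd hT)]
  refine finsum_eq_sum_of_support_subset _ fun d hd => ?_
  rw [Finset.coe_range, Set.mem_Iio]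
  by_contra! hdN
  have hTd : coeff n (T ^ d) = 0 := X_pow_dvd_iff.mp (pow_dvd_pow_of_dvd hT d) n (by omega)
  simp [hTd] at hd

theorem coeff_subst_sub_subst_eq_sum (V : R⟦X⟧) {S T : A⟦X⟧} (hS : X ∣ S) (hT : X ∣ T)
    {n N : ℕ} (hn : n < N) : coeff n ((V.subst S : A⟦X⟧) - V.subst T) =
      ∑ d ∈ Finset.range N, coeff d V • coeff n (S ^ d - T ^ d) := by
  simp only [map_sub, coeff_subst_eq_sum V hS hn, coeff_subst_eq_sum V hT hn, smul_sub,
    Finset.sum_sub_distrib]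

theorem X_pow_dvd_subst {V : R⟦X⟧} {m : ℕ} (hV : X ^ m ∣ V) {T : A⟦X⟧} (hT : X ∣ T) :
    X ^ m ∣ (V.subst T : A⟦X⟧) := by
  obtain ⟨W, rfl⟩ := hV
  rw [subst_mul (hasSubst_of_X_dvd hT), subst_pow (hasSubst_of_X_dvd hT),
    subst_X (hasSubst_of_X_dvd hT)]
  exact (pow_dvd_pow_of_dvd hT m).mul_right _

theorem coeff_subst_of_X_pow_dvd {V : R⟦X⟧} {m : ℕ} (hV : X ^ m ∣ V) {T : A⟦X⟧} (hT : X ∣ T) :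
    coeff m (V.subst T : A⟦X⟧) = coeff m V • coeff 1 T ^ m := by
  rw [coeff_subst_eq_sum V hT m.lt_succ_self, Finset.sum_range_succ, Finset.sum_eq_zero,
    zero_add, coeff_self_pow_of_X_dvd hT]
  intro d hd
  rw [X_pow_dvd_iff.mp hV d (Finset.mem_range.mp hd), zero_smul]

theorem X_pow_dvd_subst_sub_subst {V : R⟦X⟧} {m : ℕ} (hV : X ^ (m + 1) ∣ V) {S T : A⟦X⟧}
    (hS : X ∣ S) (hT : X ∣ T) {n : ℕ} (h : X ^ n ∣ S - T) :
    X ^ (n + m) ∣ (V.subst S : A⟦X⟧) - V.subst T := by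
  rw [X_pow_dvd_iff]
  intro i hi
  rw [coeff_subst_sub_subst_eq_sum V hS hT i.lt_succ_self]
  refine Finset.sum_eq_zero fun d _ => ?_
  obtain hd | ⟨j, rfl⟩ : d < m + 1 ∨ ∃ j, d = m + j + 1 := by
    rcases lt_or_ge d (m + 1) with hd | hd
    exacts [.inl hd, .inr ⟨d - (m + 1), by omega⟩]
  · rw [X_pow_dvd_iff.mp hV d hd, zero_smul]
  · rw [X_pow_dvd_iff.mp (X_pow_dvd_pow_sub_pow hS hT h (m + j)) i (by omega), smul_zero]

theorem coeff_subst_sub_subst {V : R⟦X⟧} {m : ℕ} (hV : X ^ (m + 1) ∣ V) {S T : A⟦X⟧} {a : A}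
    (hS : X ∣ S) (hS1 : coeff 1 S = a) (hT : X ∣ T) (hT1 : coeff 1 T = a) {n : ℕ}
    (h : X ^ n ∣ S - T) :
    coeff (n + m) ((V.subst S : A⟦X⟧) - V.subst T) =
      coeff (m + 1) V • ((m + 1) * a ^ m * coeff n (S - T)) := by
  rw [coeff_subst_sub_subst_eq_sum V hS hT (N := n + m + 2) (by omega),
    Finset.sum_eq_single_of_mem (m + 1) (Finset.mem_range.mpr (by omega)),
    coeff_pow_sub_pow hS hS1 hT hT1 h]
  intro d _ hdm
  obtain hd | ⟨j, rfl⟩ : d < m + 1 ∨ ∃ j, d = m + j + 2 := by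
    rcases lt_or_ge d (m + 1) with hd | hd
    exacts [.inl hd, .inr ⟨d - (m + 2), by omega⟩]
  · rw [X_pow_dvd_iff.mp hV d hd, zero_smul]
  · rw [X_pow_dvd_iff.mp (X_pow_dvd_pow_sub_pow hS hT h (m + j + 1)) (n + m) (by omega),
      smul_zero]

end Congruences

section Composition

variable {K : Type*} [Field K]

theorem tangentToId_iff {f : K⟦X⟧} : TangentToId f ↔ X ^ 2 ∣ f - X := by
  rw [TangentToId, X_pow_succ_dvd_iff, pow_one, X_dvd_iff]
  simp [sub_eq_zero]

theorem TangentToId.X_dvd {f : K⟦X⟧} (hf : TangentToId f) : X ∣ f :=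
  X_dvd_iff.mpr hf.1

theorem comp_assoc (f : K⟦X⟧) {g h : K⟦X⟧} (hg : X ∣ g) (hh : X ∣ h) :
    comp (comp f g) h = comp f (comp g h) :=
  subst_comp_subst_apply (hasSubst_of_X_dvd hg) (hasSubst_of_X_dvd hh) f

theorem comp_X (f : K⟦X⟧) : comp f X = f := X_subst f

theorem X_comp {f : K⟦X⟧} (hf : X ∣ f) : comp X f = f := subst_X (hasSubst_of_X_dvd hf)

theorem sub_comp (u v : K⟦X⟧) {f : K⟦X⟧} (hf : X ∣ f) :
    comp (u - v) f = comp u f - comp v f :=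
  subst_sub (hasSubst_of_X_dvd hf) u v

theorem X_dvd_comp {f g : K⟦X⟧} (hf : X ∣ f) (hg : X ∣ g) : X ∣ comp f g := by
  rw [← pow_one X] at hf ⊢
  exact X_pow_dvd_subst hf hg

theorem coeff_one_comp {f g : K⟦X⟧} (hf : X ∣ f) (hg : X ∣ g) :
    coeff 1 (comp f g) = coeff 1 f * coeff 1 g := by
  rw [comp, coeff_subst_of_X_pow_dvd (by rwa [pow_one]) hg, pow_one, smul_eq_mul]

theorem X_dvd_compInv (h : K⟦X⟧) (h1 : coeff 1 h ≠ 0) : X ∣ compInv h h1 :=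
  X_dvd_iff.mpr (h.constantCoeff_substInvOfIsUnit h1.isUnit)

theorem coeff_one_compInv {h : K⟦X⟧} (h0 : X ∣ h) (h1 : coeff 1 h ≠ 0) :
    coeff 1 (compInv h h1) = (coeff 1 h)⁻¹ := by
  have hX := congrArg (coeff 1) (comp_compInv h (X_dvd_iff.mp h0) h1)
  rw [coeff_one_comp h0 (X_dvd_compInv h h1), coeff_one_X] at hX
  exact eq_inv_of_mul_eq_one_right hX

theorem compInv_comp_cancel {h : K⟦X⟧} (h0 : X ∣ h) (h1 : coeff 1 h ≠ 0) {f : K⟦X⟧}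
    (hf : X ∣ f) : comp (compInv h h1) (comp h f) = f := by
  rw [← comp_assoc _ h0 hf, compInv_comp h (X_dvd_iff.mp h0) h1, X_comp hf]

theorem conj_eq_iff {h : K⟦X⟧} (h0 : X ∣ h) (h1 : coeff 1 h ≠ 0) {f g : K⟦X⟧} (hf : X ∣ f)
    (hg : X ∣ g) : conj h h1 f = g ↔ comp h f = comp g h := by
  have hi := X_dvd_compInv h h1
  constructor
  · rintro rfl
    rw [conj, comp_assoc _ (X_dvd_comp hf hi) h0, comp_assoc _ hi h0,
      compInv_comp h (X_dvd_iff.mp h0) h1, comp_X]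
  · intro hcomp
    rw [conj, ← comp_assoc _ hf hi, hcomp, comp_assoc _ h0 hi,
      comp_compInv h (X_dvd_iff.mp h0) h1, comp_X]

end Composition

section Conjugacy

variable {K : Type*} [Field K]

theorem X_dvd_of_X_pow_dvd_sub_X {f : K⟦X⟧} {q : ℕ} (hf : X ^ (q + 1) ∣ f - X) : X ∣ f :=
  (dvd_sub_left dvd_rfl).mp ((dvd_pow_self X q.succ_ne_zero).trans hf)

theorem coeff_one_of_X_pow_dvd_sub_X {f : K⟦X⟧} {q : ℕ} (hq : q ≠ 0)
    (hf : X ^ (q + 1) ∣ f - X) : coeff 1 f = 1 := by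
  rw [coeff_eq_of_X_pow_dvd_sub hf (by omega), coeff_one_X]

theorem coeff_succ_sub_X (f : K⟦X⟧) {q : ℕ} (hq : q ≠ 0) :
    coeff (q + 1) (f - X) = coeff (q + 1) f := by
  rw [map_sub, coeff_X, if_neg (by omega), sub_zero]

section LeadingTerm

variable {f g u : K⟦X⟧} {q : ℕ}

theorem sub_X_eq_of_comp_eq_comp (hf : X ∣ f) (hu : X ∣ u) (hu1 : coeff 1 u ≠ 0)
    (huf : comp u f = comp g u) :
    f - X = comp (compInv u hu1) (comp g u) - comp (compInv u hu1) u := by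
  rw [← huf, compInv_comp_cancel hu hu1 hf, compInv_comp u (X_dvd_iff.mp hu) hu1]

theorem comp_sub_self (hu : X ∣ u) : comp g u - u = comp (g - X) u := by
  rw [sub_comp g X hu, X_comp hu]

theorem X_pow_dvd_comp_sub_self (hg : X ^ (q + 1) ∣ g - X) (hu : X ∣ u) :
    X ^ (q + 1) ∣ comp g u - u := by
  rw [comp_sub_self hu]
  exact X_pow_dvd_subst hg hu

theorem X_pow_dvd_sub_X_of_comp_eq_comp (hf : X ∣ f) (hg : X ^ (q + 1) ∣ g - X) (hu : X ∣ u)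
    (hu1 : coeff 1 u ≠ 0) (huf : comp u f = comp g u) : X ^ (q + 1) ∣ f - X := by
  rw [sub_X_eq_of_comp_eq_comp hf hu hu1 huf]
  exact X_pow_dvd_subst_sub_subst (m := 0) (by simpa using X_dvd_compInv u hu1)
    (X_dvd_comp (X_dvd_of_X_pow_dvd_sub_X hg) hu) hu (X_pow_dvd_comp_sub_self hg hu)

theorem coeff_succ_of_comp_eq_comp (hq : q ≠ 0) (hf : X ∣ f) (hg : X ^ (q + 1) ∣ g - X)
    (hu : X ∣ u) (hu1 : coeff 1 u ≠ 0) (huf : comp u f = comp g u) :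
    coeff (q + 1) f = coeff 1 u ^ q * coeff (q + 1) g := by
  have hgX := X_dvd_of_X_pow_dvd_sub_X hg
  have hgu1 : coeff 1 (comp g u) = coeff 1 u := by
    rw [coeff_one_comp hgX hu, coeff_one_of_X_pow_dvd_sub_X hq hg, one_mul]
  have hlead : coeff (q + 1) (comp g u - u) = coeff (q + 1) g * coeff 1 u ^ (q + 1) := by
    rw [comp_sub_self hu, comp, coeff_subst_of_X_pow_dvd hg hu, coeff_succ_sub_X g hq, smul_eq_mul]
  have hcoeff := coeff_subst_sub_subst (m := 0) (by simpa using X_dvd_compInv u hu1)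
    (X_dvd_comp hgX hu) hgu1 hu rfl (X_pow_dvd_comp_sub_self hg hu)
  rw [← coeff_succ_sub_X f hq, sub_X_eq_of_comp_eq_comp hf hu hu1 huf]
  refine hcoeff.trans ?_
  rw [hlead, zero_add, coeff_one_compInv hu hu1, smul_eq_mul]
  push_cast
  field_simp
  ring

end LeadingTerm

/-- The defect of `u` as a semiconjugacy from `f` to `g`: it vanishes if and only if
`u ∘ f = g ∘ u`. -/
noncomputable def defect (f g u : K⟦X⟧) : K⟦X⟧ := comp u f - comp g u

theorem defect_eq_zero_iff {f g u : K⟦X⟧} : defect f g u = 0 ↔ comp u f = comp g u :=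
  sub_eq_zero

section Linearization

variable {f g u v : K⟦X⟧} {q n : ℕ}

theorem defect_sub_defect (hf : X ∣ f) (hu : X ∣ u) (hv : X ∣ v) :
    defect f g u - defect f g v =
      (comp (u - v) f - comp (u - v) X) - (comp (g - X) u - comp (g - X) v) := by
  rw [sub_comp u v hf, comp_X, ← comp_sub_self hu, ← comp_sub_self hv, defect, defect]
  ring

theorem X_pow_dvd_defect_sub_defect (hf : X ^ (q + 1) ∣ f - X) (hg : X ^ (q + 1) ∣ g - X)
    (hu : X ∣ u) (hv : X ∣ v) (h : X ^ (n + 1) ∣ u - v) :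
    X ^ (n + 1 + q) ∣ defect f g u - defect f g v := by
  have hfX := X_dvd_of_X_pow_dvd_sub_X hf
  have hleft := X_pow_dvd_subst_sub_subst h hfX dvd_rfl hf
  rw [show q + 1 + n = n + 1 + q by omega] at hleft
  rw [defect_sub_defect hfX hu hv]
  exact dvd_sub hleft (X_pow_dvd_subst_sub_subst hg hu hv h)

/-- The term `n * α` comes from `(u - v) ∘ f - (u - v)` and the term `q * α` from the derivative of
`g`; they cancel at the resonance `n = q`. -/
theorem coeff_defect_sub_defect {a : K} (hq : q ≠ 0) (hf : X ^ (q + 1) ∣ f - X)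
    (hg : X ^ (q + 1) ∣ g - X) (hfg : coeff (q + 1) f = a ^ q * coeff (q + 1) g) (hu : X ∣ u)
    (hu1 : coeff 1 u = a) (hv : X ∣ v) (hv1 : coeff 1 v = a) (h : X ^ (n + 1) ∣ u - v) :
    coeff (n + 1 + q) (defect f g u - defect f g v) =
      (n - q) * coeff (q + 1) f * coeff (n + 1) (u - v) := by
  have hfX := X_dvd_of_X_pow_dvd_sub_X hf
  have hleft := coeff_subst_sub_subst h hfX (coeff_one_of_X_pow_dvd_sub_X hq hf) dvd_rfl
    coeff_one_X hf
  have hright := coeff_subst_sub_subst hg hu hu1 hv hv1 h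
  rw [show q + 1 + n = n + 1 + q by omega, coeff_succ_sub_X f hq] at hleft
  rw [coeff_succ_sub_X g hq] at hright
  rw [defect_sub_defect hfX hu hv, map_sub, comp, comp, comp, comp, hleft, hright, hfg]
  simp only [smul_eq_mul, one_pow]
  ring

theorem eq_of_comp_eq_comp [CharZero K] (hq : q ≠ 0) (hf : X ^ (q + 1) ∣ f - X)
    (hf0 : coeff (q + 1) f ≠ 0) (hg : X ^ (q + 1) ∣ g - X)
    (hfg : coeff (q + 1) f = coeff 1 v ^ q * coeff (q + 1) g)
    (hu : X ∣ u) (hv : X ∣ v) (huf : comp u f = comp g u) (hvf : comp v f = comp g v)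
    (h1 : coeff 1 u = coeff 1 v) (hres : coeff (q + 1) u = coeff (q + 1) v) : u = v := by
  refine eq_of_forall_X_pow_dvd_sub fun n => (pow_dvd_pow X (Nat.le_add_right n 1)).trans ?_
  induction n with
  | zero => rw [zero_add, pow_one]; exact dvd_sub hu hv
  | succ n ih =>
    refine X_pow_succ_dvd_iff.mpr ⟨ih, ?_⟩
    obtain rfl | hnq := eq_or_ne n q
    · rw [map_sub, hres, sub_self]
    have hlin := coeff_defect_sub_defect hq hf hg hfg hu h1 hv rfl ih
    rw [defect_eq_zero_iff.mpr huf, defect_eq_zero_iff.mpr hvf, sub_zero, map_zero] at hlin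
    have hnq' : (n : K) - q ≠ 0 := sub_ne_zero.mpr (Nat.cast_injective.ne hnq)
    exact (mul_eq_zero.mp hlin.symm).resolve_left (mul_ne_zero hnq' hf0)

theorem exists_X_pow_dvd_defect [CharZero K] (hq : q ≠ 0) (hf : X ^ (q + 1) ∣ f - X)
    (hf0 : coeff (q + 1) f ≠ 0) (hg : X ^ (q + 1) ∣ g - X)
    (hfg : coeff (q + 1) f = coeff 1 u ^ q * coeff (q + 1) g) (hu : X ∣ u) (hn : q < n)
    (h : X ^ (n + 1 + q) ∣ defect f g u) :
    ∃ v, X ^ (n + 1) ∣ v - u ∧ X ^ (n + 2 + q) ∣ defect f g v := by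
  have hnq : (n : K) - q ≠ 0 := sub_ne_zero.mpr (Nat.cast_injective.ne hn.ne')
  set c := -(coeff (n + 1 + q) (defect f g u) / ((n - q) * coeff (q + 1) f)) with hc
  have hdiff : u + C c * X ^ (n + 1) - u = C c * X ^ (n + 1) := add_sub_cancel_left _ _
  have hdvd : X ^ (n + 1) ∣ u + C c * X ^ (n + 1) - u := by
    rw [hdiff]
    exact dvd_mul_left _ _
  have hv : X ∣ u + C c * X ^ (n + 1) :=
    dvd_add hu ((dvd_pow_self X n.succ_ne_zero).mul_left _)
  have hv1 : coeff 1 (u + C c * X ^ (n + 1)) = coeff 1 u :=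
    coeff_eq_of_X_pow_dvd_sub hdvd (by omega)
  refine ⟨u + C c * X ^ (n + 1), hdvd, ?_⟩
  rw [show n + 2 + q = n + 1 + q + 1 by omega, X_pow_succ_dvd_iff]
  refine ⟨(dvd_sub_left h).mp (X_pow_dvd_defect_sub_defect hf hg hv hu hdvd), ?_⟩
  have hlin := coeff_defect_sub_defect hq hf hg hfg hv hv1 hu rfl hdvd
  rw [hdiff, coeff_C_mul, coeff_X_pow_self, map_sub, hc] at hlin
  rw [sub_eq_iff_eq_add.mp hlin]
  field_simp
  ring

theorem exists_comp_eq_comp [CharZero K] (hq : q ≠ 0) (hf : X ^ (q + 1) ∣ f - X)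
    (hf0 : coeff (q + 1) f ≠ 0) (hg : X ^ (q + 1) ∣ g - X) (hfg : X ^ (2 * q + 2) ∣ f - g) :
    ∃ u : K⟦X⟧, TangentToId u ∧ comp u f = comp g u := by
  have hlead (u : K⟦X⟧) (hu : TangentToId u) :
      coeff (q + 1) f = coeff 1 u ^ q * coeff (q + 1) g := by
    rw [hu.2, one_pow, one_mul, coeff_eq_of_X_pow_dvd_sub hfg (by omega)]
  obtain ⟨u, hu⟩ := exists_forall_X_pow_dvd_sub
    (P := fun n u => TangentToId u ∧ X ^ (n + (2 * q + 2)) ∣ defect f g u)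
    ⟨X, tangentToId_iff.mpr (by simp), by
      rwa [zero_add, defect, comp_X, X_comp (X_dvd_of_X_pow_dvd_sub_X hf)]⟩
    fun n u ⟨hu, hdefect⟩ => by
      obtain ⟨v, hvu, hv⟩ := exists_X_pow_dvd_defect (n := n + (q + 1)) hq hf hf0 hg (hlead u hu)
        hu.X_dvd (by omega) ((pow_dvd_pow X (by omega)).trans hdefect)
      refine ⟨v, (pow_dvd_pow X (by omega)).trans hvu, tangentToId_iff.mpr ?_,
        (pow_dvd_pow X (by omega)).trans hv⟩
      rw [← sub_add_sub_cancel v u]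
      exact dvd_add ((pow_dvd_pow X (by omega)).trans hvu) (tangentToId_iff.mp hu)
  have htangent : TangentToId u := by
    obtain ⟨v, ⟨hv, -⟩, huv⟩ := hu 2
    rw [tangentToId_iff, ← sub_add_sub_cancel u v]
    exact dvd_add huv (tangentToId_iff.mp hv)
  refine ⟨u, htangent, eq_of_forall_X_pow_dvd_sub fun n => ?_⟩
  obtain ⟨v, ⟨hv, hdefect⟩, huv⟩ := hu (n + 1)
  have hlin := X_pow_dvd_defect_sub_defect hf hg htangent.X_dvd hv.X_dvd huv
  exact (pow_dvd_pow X (by omega)).trans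
    ((dvd_sub_left ((pow_dvd_pow X (by omega)).trans hdefect)).mp hlin)

theorem coeff_defect_trunc {h : K⟦X⟧} (hq : q ≠ 0) (hf : X ^ (q + 1) ∣ f - X)
    (hg : X ^ (q + 1) ∣ g - X) (hfg : coeff (q + 1) f = coeff 1 h ^ q * coeff (q + 1) g)
    (hh : X ∣ h) (hcomp : comp h f = comp g h) (p : ℕ) :
    coeff (2 * q + 2 + p) (defect f g (trunc (q + 2 + p) h)) =
      -((p + 1) * coeff (q + 1) f * coeff (q + 2 + p) h) := by
  have hcoeff (i : ℕ) (hi : i < q + 2 + p) :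
      coeff i (trunc (q + 2 + p) h : K⟦X⟧) = coeff i h := coeff_coe_trunc_of_lt hi
  have hdvd : X ^ (q + 1 + p + 1) ∣ (trunc (q + 2 + p) h : K⟦X⟧) - h :=
    X_pow_dvd_iff.mpr fun i hi => by rw [map_sub, hcoeff i (by omega), sub_self]
  have htrunc : X ∣ (trunc (q + 2 + p) h : K⟦X⟧) :=
    (dvd_iff_dvd_of_dvd_sub ((dvd_pow_self X (by omega)).trans hdvd)).mpr hh
  have hlin := coeff_defect_sub_defect hq hf hg hfg htrunc (hcoeff 1 (by omega)) hh rfl hdvd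
  rw [defect_eq_zero_iff.mpr hcomp, sub_zero, map_sub, show q + 1 + p + 1 = q + 2 + p by omega,
    Polynomial.coeff_coe, coeff_trunc, if_neg (lt_irrefl _)] at hlin
  rw [show 2 * q + 2 + p = q + 2 + p + q by omega, hlin]
  push_cast
  ring

end Linearization

end Conjugacy

section BaseChange

variable {R A B : Type*} [CommRing R] [CommRing A] [CommRing B] [Algebra R A] [Algebra R B]

theorem X_dvd_map (φ : A →+* B) {T : A⟦X⟧} (hT : X ∣ T) : X ∣ PowerSeries.map φ T := by
  simpa only [map_X] using map_dvd (PowerSeries.map φ) hT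

theorem map_subst_of_X_dvd (φ : A →+* B) (U : A⟦X⟧) {T : A⟦X⟧} (hT : X ∣ T) :
    PowerSeries.map φ (U.subst T) = (PowerSeries.map φ U).subst (PowerSeries.map φ T) :=
  map_subst (hasSubst_of_X_dvd hT) U

theorem map_subst_algHom (φ : A →ₐ[R] B) (V : R⟦X⟧) {T : A⟦X⟧} (hT : X ∣ T) :
    PowerSeries.map (φ : A →+* B) (V.subst T) = V.subst (PowerSeries.map (φ : A →+* B) T) := by
  ext n
  rw [coeff_map, coeff_subst_eq_sum V hT n.lt_succ_self,
    coeff_subst_eq_sum V (X_dvd_map _ hT) n.lt_succ_self, map_sum]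
  refine Finset.sum_congr rfl fun d _ => ?_
  rw [← map_pow, coeff_map]
  exact map_smul φ _ _

end BaseChange

section FlowLaws

variable {K : Type*} [Field K]

theorem timeDeriv_map_taylor (s : K) (T : (Polynomial K)⟦X⟧) :
    timeDeriv (PowerSeries.map (Polynomial.taylorAlgHom s : Polynomial K →+* Polynomial K) T) =
      PowerSeries.map (Polynomial.taylorAlgHom s : Polynomial K →+* Polynomial K)
        (timeDeriv T) := by
  ext1 n
  simp [timeDeriv, Polynomial.taylor_apply, Polynomial.derivative_comp]

theorem timeDeriv_subst_map_C (T : (Polynomial K)⟦X⟧) {S : K⟦X⟧} (hS : X ∣ S) :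
    timeDeriv (T.subst (PowerSeries.map Polynomial.C S)) =
      (timeDeriv T).subst (PowerSeries.map Polynomial.C S) := by
  have hS' := X_dvd_map Polynomial.C hS
  ext1 n
  rw [timeDeriv, coeff_mk, coeff_subst_eq_sum T hS' n.lt_succ_self,
    coeff_subst_eq_sum _ hS' n.lt_succ_self, Polynomial.derivative_sum]
  refine Finset.sum_congr rfl fun d _ => ?_
  rw [← map_pow, coeff_map, smul_eq_mul, smul_eq_mul, Polynomial.derivative_mul,
    Polynomial.derivative_C, mul_zero, add_zero, timeDeriv, coeff_mk]

theorem eq_of_timeDeriv_eq_subst [CharZero K] {V : K⟦X⟧} (hV : X ^ 2 ∣ V)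
    {S T : (Polynomial K)⟦X⟧} (hS : X ∣ S) (hT : X ∣ T) (hS' : timeDeriv S = V.subst S)
    (hT' : timeDeriv T = V.subst T)
    (h0 : PowerSeries.map (Polynomial.evalRingHom 0) S =
      PowerSeries.map (Polynomial.evalRingHom 0) T) : S = T := by
  refine eq_of_forall_X_pow_dvd_sub fun n => ?_
  induction n with
  | zero => simp
  | succ n ih =>
    refine X_pow_succ_dvd_iff.mpr ⟨ih, ?_⟩
    rw [map_sub, sub_eq_zero]
    refine eq_of_derivative_eq ?_ (by simpa using congrArg (coeff n) h0)
    have hcoeff :=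
      coeff_eq_of_X_pow_dvd_sub (X_pow_dvd_subst_sub_subst hV hS hT ih) n.lt_succ_self
    rw [← hS', ← hT'] at hcoeff
    simpa only [timeDeriv, coeff_mk] using hcoeff

theorem X_dvd_timeMap {V : K⟦X⟧} (hV : X ^ 2 ∣ V) (t : K) : X ∣ timeMap V t :=
  X_dvd_map _ (dvd_flow hV)

theorem timeMap_zero [CharZero K] {V : K⟦X⟧} (hV : X ^ 2 ∣ V) : timeMap V 0 = X :=
  (isFormalFlow_flow hV).2.1

theorem map_eval_subst_map_C (t : K) (T : (Polynomial K)⟦X⟧) {S : K⟦X⟧} (hS : X ∣ S) :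
    PowerSeries.map (Polynomial.evalRingHom t) (T.subst (PowerSeries.map Polynomial.C S)) =
      comp (PowerSeries.map (Polynomial.evalRingHom t) T) S := by
  rw [map_subst_of_X_dvd _ _ (X_dvd_map _ hS), comp]
  congr 1
  ext n
  simp

theorem map_eval_map_taylor (s t : K) (T : (Polynomial K)⟦X⟧) :
    PowerSeries.map (Polynomial.evalRingHom t)
      (PowerSeries.map (Polynomial.taylorAlgHom s : Polynomial K →+* Polynomial K) T) =
      PowerSeries.map (Polynomial.evalRingHom (t + s)) T := by
  ext n
  simp [Polynomial.taylor_eval]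

theorem flow_subst_timeMap [CharZero K] {V : K⟦X⟧} (hV : X ^ 2 ∣ V) (s : K) :
    (flow V).subst (PowerSeries.map Polynomial.C (timeMap V s)) =
      PowerSeries.map (Polynomial.taylorAlgHom s : Polynomial K →+* Polynomial K) (flow V) := by
  obtain ⟨-, -, hflow⟩ := isFormalFlow_flow hV
  have hF := dvd_flow hV
  have hS := X_dvd_timeMap hV s
  have hS' := X_dvd_map Polynomial.C hS
  have hFS : X ∣ (flow V).subst (PowerSeries.map Polynomial.C (timeMap V s)) := by
    rw [← pow_one X] at hF ⊢
    exact X_pow_dvd_subst hF hS'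
  refine eq_of_timeDeriv_eq_subst hV hFS (X_dvd_map _ hF) ?_ ?_ ?_
  · rw [timeDeriv_subst_map_C _ hS, hflow]
    exact subst_comp_subst_apply (hasSubst_of_X_dvd hF) (hasSubst_of_X_dvd hS') V
  · rw [timeDeriv_map_taylor, hflow, map_subst_algHom _ V hF]
  · rw [map_eval_subst_map_C _ _ hS, map_eval_map_taylor, zero_add]
    change comp (timeMap V 0) (timeMap V s) = timeMap V s
    rw [timeMap_zero hV, X_comp hS]

theorem comp_timeMap_timeMap [CharZero K] {V : K⟦X⟧} (hV : X ^ 2 ∣ V) (s t : K) :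
    comp (timeMap V t) (timeMap V s) = timeMap V (t + s) := by
  have h := congrArg (PowerSeries.map (Polynomial.evalRingHom t)) (flow_subst_timeMap hV s)
  rwa [map_eval_subst_map_C _ _ (X_dvd_timeMap hV s), map_eval_map_taylor] at h

theorem comp_timeMap_comm [CharZero K] {V : K⟦X⟧} (hV : X ^ 2 ∣ V) (s t : K) :
    comp (timeMap V s) (timeMap V t) = comp (timeMap V t) (timeMap V s) := by
  rw [comp_timeMap_timeMap hV, comp_timeMap_timeMap hV, add_comm]

end FlowLaws

section FlowCoefficients

variable {K : Type*} [Field K]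

theorem coeff_subst_X_eq_C (V : K⟦X⟧) (n : ℕ) :
    coeff n (V.subst (X : (Polynomial K)⟦X⟧) : (Polynomial K)⟦X⟧) = Polynomial.C (coeff n V) := by
  rw [← map_algebraMap_eq_subst_X, coeff_map, Polynomial.algebraMap_eq]

theorem X_sq_dvd_of_X_pow_succ_dvd {V : K⟦X⟧} {q : ℕ} (hq : q ≠ 0)
    (hV : X ^ (q + 1) ∣ V) : X ^ 2 ∣ V :=
  (pow_dvd_pow X (by omega)).trans hV

variable [CharZero K] {V : K⟦X⟧} {q : ℕ}

theorem coeff_flow_eq_of_derivative_eq (hV : X ^ 2 ∣ V) {n : ℕ} {p : Polynomial K}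
    (hp : Polynomial.derivative p = coeff n (V.subst (flow V) : (Polynomial K)⟦X⟧))
    (hp0 : p.eval 0 = coeff n (X : K⟦X⟧)) : coeff n (flow V) = p := by
  obtain ⟨-, hzero, hflow⟩ := isFormalFlow_flow hV
  refine eq_of_derivative_eq ?_ ?_
  · rw [hp, ← hflow, timeDeriv, coeff_mk]
  · rw [hp0, ← hzero, coeff_map, Polynomial.coe_evalRingHom]

theorem X_pow_dvd_flow_sub_X (hq : q ≠ 0) (hV : X ^ (q + 1) ∣ V) :
    X ^ (q + 1) ∣ flow V - X := by
  have hV2 := X_sq_dvd_of_X_pow_succ_dvd hq hV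
  rw [X_pow_dvd_iff]
  intro n hn
  rw [map_sub, sub_eq_zero,
    coeff_flow_eq_of_derivative_eq hV2 (p := Polynomial.C (coeff n (X : K⟦X⟧)))]
  · rw [coeff_X, coeff_X, apply_ite Polynomial.C, map_one, map_zero]
  · rw [Polynomial.derivative_C, X_pow_dvd_iff.mp (X_pow_dvd_subst hV (dvd_flow hV2)) n hn]
  · rw [Polynomial.eval_C]

theorem coeff_flow_of_lt (hq : q ≠ 0) (hV : X ^ (q + 1) ∣ V) {n : ℕ} (hn : n < 2 * q + 1) :
    coeff n (flow V) =
      Polynomial.C (coeff n (X : K⟦X⟧)) + Polynomial.C (coeff n V) * Polynomial.X := by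
  have hV2 := X_sq_dvd_of_X_pow_succ_dvd hq hV
  refine coeff_flow_eq_of_derivative_eq hV2 ?_ (by simp)
  have hsubst := X_pow_dvd_subst_sub_subst hV (dvd_flow hV2) dvd_rfl (X_pow_dvd_flow_sub_X hq hV)
  rw [coeff_eq_of_X_pow_dvd_sub hsubst (by omega), coeff_subst_X_eq_C]
  simp

theorem coeff_two_mul_add_one_flow (hq : q ≠ 0) (hV : X ^ (q + 1) ∣ V) :
    coeff (2 * q + 1) (flow V) = Polynomial.C (coeff (2 * q + 1) V) * Polynomial.X +
      Polynomial.C ((q + 1) / 2 * coeff (q + 1) V ^ 2) * Polynomial.X ^ 2 := by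
  have hV2 := X_sq_dvd_of_X_pow_succ_dvd hq hV
  have hflow := X_pow_dvd_flow_sub_X hq hV
  refine coeff_flow_eq_of_derivative_eq hV2 ?_ (by simp [coeff_X, hq])
  have hsubst := coeff_subst_sub_subst hV (dvd_flow hV2)
    ((coeff_eq_of_X_pow_dvd_sub hflow (by omega)).trans coeff_one_X) dvd_rfl coeff_one_X hflow
  have hlead : coeff (q + 1) (flow V - X) = Polynomial.C (coeff (q + 1) V) * Polynomial.X := by
    rw [map_sub, coeff_flow_of_lt hq hV (by omega)]
    simp [coeff_X, hq]
  rw [show q + 1 + q = 2 * q + 1 by omega, map_sub, coeff_subst_X_eq_C, hlead,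
    sub_eq_iff_eq_add] at hsubst
  rw [hsubst]
  have htwo : (Polynomial.C ((q + 1) / 2 * coeff (q + 1) V ^ 2) : Polynomial K) * 2 =
      (q + 1) * Polynomial.C (coeff (q + 1) V) ^ 2 := by
    rw [← map_ofNat Polynomial.C 2, ← map_mul, mul_right_comm, div_mul_cancel₀ _ two_ne_zero]
    simp
  rw [map_add, Polynomial.derivative_C_mul, Polynomial.derivative_C_mul, Polynomial.derivative_X,
    Polynomial.derivative_X_pow, Polynomial.smul_eq_C_mul]
  simp only [Nat.cast_ofNat, map_ofNat]
  linear_combination Polynomial.X * htwo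

theorem coeff_timeMap_of_lt (hq : q ≠ 0) (hV : X ^ (q + 1) ∣ V) (t : K) {n : ℕ}
    (hn : n < 2 * q + 1) : coeff n (timeMap V t) = coeff n X + coeff n V * t := by
  rw [timeMap, coeff_map, coeff_flow_of_lt hq hV hn]
  simp

theorem coeff_succ_timeMap (hq : q ≠ 0) (hV : X ^ (q + 1) ∣ V) (t : K) :
    coeff (q + 1) (timeMap V t) = coeff (q + 1) V * t := by
  rw [coeff_timeMap_of_lt hq hV t (by omega), coeff_X, if_neg (by omega), zero_add]

theorem coeff_two_mul_add_one_timeMap (hq : q ≠ 0) (hV : X ^ (q + 1) ∣ V) (t : K) :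
    coeff (2 * q + 1) (timeMap V t) =
      coeff (2 * q + 1) V * t + (q + 1) / 2 * coeff (q + 1) V ^ 2 * t ^ 2 := by
  rw [timeMap, coeff_map, coeff_two_mul_add_one_flow hq hV]
  simp

theorem X_pow_dvd_timeMap_sub_X (hq : q ≠ 0) (hV : X ^ (q + 1) ∣ V) (t : K) :
    X ^ (q + 1) ∣ timeMap V t - X := by
  rw [X_pow_dvd_iff]
  intro n hn
  rw [map_sub, coeff_timeMap_of_lt hq hV t (by omega), X_pow_dvd_iff.mp hV n hn, zero_mul,
    add_zero, sub_self]

theorem tangentToId_timeMap (hV : X ^ 2 ∣ V) (t : K) : TangentToId (timeMap V t) :=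
  tangentToId_iff.mpr (X_pow_dvd_timeMap_sub_X one_ne_zero hV t)

end FlowCoefficients

section NormalForm

variable {K : Type*} [Field K]

/-- The polynomial normal form with invariants `m = q + 1` and `μ`. -/
noncomputable def normalForm (q : ℕ) (μ : K) : K⟦X⟧ :=
  X + X ^ (q + 1) + C μ * X ^ (2 * q + 1)

theorem X_pow_dvd_normalForm_sub_X (q : ℕ) (μ : K) : X ^ (q + 1) ∣ normalForm q μ - X := by
  rw [normalForm, add_assoc, add_sub_cancel_left]
  exact dvd_add dvd_rfl ((pow_dvd_pow X (by omega)).mul_left _)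

theorem coeff_succ_normalForm {q : ℕ} (hq : q ≠ 0) (μ : K) :
    coeff (q + 1) (normalForm q μ) = 1 := by
  rw [normalForm, map_add, map_add, coeff_X, coeff_X_pow, coeff_C_mul, coeff_X_pow,
    if_neg (by omega), if_pos rfl, if_neg (by omega), zero_add, mul_zero, add_zero]

theorem comp_normalForm (q : ℕ) (μ : K) {u : K⟦X⟧} (hu : X ∣ u) :
    comp (normalForm q μ) u = u + u ^ (q + 1) + C μ * u ^ (2 * q + 1) := by
  have hs := hasSubst_of_X_dvd hu
  have hC : (C μ).subst u = C μ := subst_C μ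
  rw [comp, normalForm, subst_add hs, subst_add hs, subst_mul hs, subst_pow hs, subst_pow hs,
    subst_X hs, hC]

theorem C_mul_comp (a : K) (u : K⟦X⟧) {f : K⟦X⟧} (hf : X ∣ f) :
    comp (C a * u) f = C a * comp u f := by
  have hC : (C a).subst f = C a := subst_C a
  rw [comp, subst_mul (hasSubst_of_X_dvd hf), hC, comp]

theorem comp_normalForm_C_mul {q : ℕ} (μ : K) {a : K} (ha : a ^ q = 1) {u : K⟦X⟧} (hu : X ∣ u) :
    comp (normalForm q μ) (C a * u) = C a * comp (normalForm q μ) u := by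
  have hCa : (C a : K⟦X⟧) ^ q = 1 := by rw [← map_pow, ha, map_one]
  rw [comp_normalForm q μ (hu.mul_left _), comp_normalForm q μ hu]
  linear_combination (C a * u ^ (q + 1) + C μ * C a * u ^ (2 * q + 1) * (C a ^ q + 1)) * hCa

theorem exists_comp_eq_comp_normalForm {f : K⟦X⟧} (hf : TangentToId f) {q : ℕ} {μ : K}
    (hinv : HasInvariants f (q + 1) μ) : ∃ u : K⟦X⟧, X ∣ u ∧ coeff 1 u ≠ 0 ∧
      (coeff (q + 1) f = 1 → coeff 1 u = 1) ∧ comp u f = comp (normalForm q μ) u := by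
  obtain ⟨hq, H, H1, H0, hconj⟩ := hinv
  rw [show 2 * (q + 1) - 1 = 2 * q + 1 by omega] at hconj
  have hH := X_dvd_iff.mpr H0
  have hN := X_pow_dvd_normalForm_sub_X q μ
  have hHf : comp H f = comp (normalForm q μ) H :=
    (conj_eq_iff hH H1 hf.X_dvd (X_dvd_of_X_pow_dvd_sub_X hN)).mp hconj
  by_cases hlead : coeff (q + 1) f = 1
  · have hpow : coeff 1 H ^ q = 1 := by
      rw [← hlead, coeff_succ_of_comp_eq_comp (by omega) hf.X_dvd hN hH H1 hHf,
        coeff_succ_normalForm (by omega), mul_one]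
    have h1 : coeff 1 (C (coeff 1 H)⁻¹ * H) = 1 := by rw [coeff_C_mul, inv_mul_cancel₀ H1]
    refine ⟨C (coeff 1 H)⁻¹ * H, hH.mul_left _, h1 ▸ one_ne_zero, fun _ => h1, ?_⟩
    rw [C_mul_comp _ _ hf.X_dvd, comp_normalForm_C_mul μ (by rw [inv_pow, hpow, inv_one]) hH, hHf]
  · exact ⟨H, hH, H1, fun h => absurd h hlead, hHf⟩

theorem X_pow_dvd_modelField (m : ℕ) (μ : K) : X ^ m ∣ modelField m μ :=
  dvd_mul_right _ _

theorem X_pow_dvd_modelField_sub {q : ℕ} (hq : q ≠ 0) (μ : K) :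
    X ^ (2 * q + 2) ∣ modelField (q + 1) μ -
      (X ^ (q + 1) + C (μ - ((q + 1 : ℕ) : K) / 2) * X ^ (2 * q + 1)) := by
  set ν := μ - ((q + 1 : ℕ) : K) / 2 with hν
  have hinv : (1 - C ν * X ^ q : K⟦X⟧)⁻¹ * (1 - C ν * X ^ q) = 1 :=
    PowerSeries.inv_mul_cancel _ (by simp [hq])
  refine (pow_dvd_pow X (show 2 * q + 2 ≤ 3 * q + 1 by omega)).trans
    ⟨C ν ^ 2 * (1 - C ν * X ^ q : K⟦X⟧)⁻¹, ?_⟩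
  rw [modelField, ← hν, Nat.add_sub_cancel]
  linear_combination X ^ (q + 1) * (1 + C ν * X ^ q) * hinv

theorem coeff_modelField {q : ℕ} (hq : q ≠ 0) (μ : K) {n : ℕ} (hn : n < 2 * q + 2) :
    coeff n (modelField (q + 1) μ) = (if n = q + 1 then 1 else 0) +
      (if n = 2 * q + 1 then μ - ((q + 1 : ℕ) : K) / 2 else 0) := by
  rw [coeff_eq_of_X_pow_dvd_sub (X_pow_dvd_modelField_sub hq μ) hn, map_add, coeff_C_mul,
    coeff_X_pow, coeff_X_pow, mul_ite, mul_one, mul_zero]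

theorem coeff_succ_modelField {q : ℕ} (hq : q ≠ 0) (μ : K) :
    coeff (q + 1) (modelField (q + 1) μ) = 1 := by
  rw [coeff_modelField hq μ (by omega), if_pos rfl, if_neg (by omega), add_zero]

theorem X_pow_dvd_normalForm_sub_timeMap [CharZero K] {q : ℕ} (hq : q ≠ 0) (μ : K) :
    X ^ (2 * q + 2) ∣ normalForm q μ - timeMap (modelField (q + 1) μ) 1 := by
  have hV := X_pow_dvd_modelField (q + 1) μ
  rw [X_pow_succ_dvd_iff, X_pow_dvd_iff]
  refine ⟨fun n hn => ?_, ?_⟩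
  · rw [map_sub, coeff_timeMap_of_lt hq hV 1 hn, coeff_modelField hq μ (by omega), normalForm]
    simp [coeff_X_pow, coeff_C_mul, hn.ne]
  · rw [map_sub, coeff_two_mul_add_one_timeMap hq hV, coeff_succ_modelField hq,
      coeff_modelField hq μ (by omega), normalForm]
    simp [coeff_X_pow, coeff_X, hq, show 2 * q ≠ q by omega]

theorem exists_comp_eq_comp_timeMap [CharZero K] {f : K⟦X⟧} (hf : TangentToId f) {q : ℕ} {μ : K}
    (hinv : HasInvariants f (q + 1) μ) : ∃ h : K⟦X⟧, X ∣ h ∧ coeff 1 h ≠ 0 ∧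
      (coeff (q + 1) f = 1 → coeff 1 h = 1) ∧
      comp h f = comp (timeMap (modelField (q + 1) μ) 1) h := by
  have hq : q ≠ 0 := by have := hinv.1; omega
  have hV := X_pow_dvd_modelField (q + 1) μ
  have hN := X_pow_dvd_normalForm_sub_X q μ
  have hNX := X_dvd_of_X_pow_dvd_sub_X hN
  obtain ⟨u, hu, hu1, hu_lead, huf⟩ := exists_comp_eq_comp_normalForm hf hinv
  obtain ⟨v, hv, hvN⟩ := exists_comp_eq_comp hq hN
    (by rw [coeff_succ_normalForm hq]; exact one_ne_zero) (X_pow_dvd_timeMap_sub_X hq hV 1)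
    (X_pow_dvd_normalForm_sub_timeMap hq μ)
  have h1 : coeff 1 (comp v u) = coeff 1 u := by rw [coeff_one_comp hv.X_dvd hu, hv.2, one_mul]
  refine ⟨comp v u, X_dvd_comp hv.X_dvd hu, h1 ▸ hu1, fun h => h1.trans (hu_lead h), ?_⟩
  rw [comp_assoc _ hu hf.X_dvd, huf, ← comp_assoc _ hNX hu, hvN, comp_assoc _ hv.X_dvd hu]

end NormalForm

section Centralizers

variable {K : Type*} [Field K]

theorem formalCentralizer_timeMap_one [CharZero K] {V : K⟦X⟧} {q : ℕ} (hq : q ≠ 0)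
    (hV : X ^ (q + 1) ∣ V) (hV0 : coeff (q + 1) V ≠ 0) :
    formalCentralizer (timeMap V 1) = Set.range (timeMap V) := by
  have hV2 := X_sq_dvd_of_X_pow_succ_dvd hq hV
  ext g
  constructor
  · rintro ⟨hg, hcomm⟩
    refine ⟨(coeff (q + 1) V)⁻¹ * coeff (q + 1) g, Eq.symm ?_⟩
    have htangent := tangentToId_timeMap hV2 ((coeff (q + 1) V)⁻¹ * coeff (q + 1) g)
    have hdvd := X_pow_dvd_timeMap_sub_X hq hV 1
    refine eq_of_comp_eq_comp hq hdvd ?_ hdvd ?_ hg.X_dvd htangent.X_dvd hcomm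
      (comp_timeMap_comm hV2 _ _) (hg.2.trans htangent.2.symm) ?_
    · rwa [coeff_succ_timeMap hq hV, mul_one]
    · rw [htangent.2, one_pow, one_mul]
    · rw [coeff_succ_timeMap hq hV, mul_inv_cancel_left₀ hV0]
  · rintro ⟨t, rfl⟩
    exact ⟨tangentToId_timeMap hV2 t, comp_timeMap_comm hV2 _ _⟩

section Transport

variable {f g h i : K⟦X⟧}

theorem comp_eq_comp_of_inverse (hf : X ∣ f) (hh : X ∣ h) (hi : X ∣ i)
    (hhi : comp h i = X) (hih : comp i h = X) (hfg : comp h f = comp g h) :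
    comp i g = comp f i := by
  calc comp i g = comp i (comp (comp g h) i) := by rw [comp_assoc g hh hi, hhi, comp_X]
    _ = comp (comp i h) (comp f i) := by
        rw [← hfg, comp_assoc h hf hi, comp_assoc i hh (X_dvd_comp hf hi)]
    _ = comp f i := by rw [hih, X_comp (X_dvd_comp hf hi)]

theorem comp_comp_mem_formalCentralizer (hf : X ∣ f) (hg : X ∣ g) (hh : X ∣ h) (hi : X ∣ i)
    (hhi : comp h i = X) (hih : comp i h = X) (hfg : comp h f = comp g h) {k : K⟦X⟧}
    (hk : k ∈ formalCentralizer g) : comp i (comp k h) ∈ formalCentralizer f := by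
  obtain ⟨hkt, hkg⟩ := hk
  have hkh := X_dvd_comp hkt.X_dvd hh
  refine ⟨⟨X_dvd_iff.mp (X_dvd_comp hi hkh), ?_⟩, ?_⟩
  · rw [coeff_one_comp hi hkh, coeff_one_comp hkt.X_dvd hh, hkt.2, one_mul,
      ← coeff_one_comp hi hh, hih, coeff_one_X]
  · calc comp (comp i (comp k h)) f = comp i (comp (comp k g) h) := by
          rw [comp_assoc _ hkh hf, comp_assoc _ hh hf, hfg, comp_assoc _ hg hh]
      _ = comp (comp i g) (comp k h) := by
          rw [hkg, comp_assoc _ hkt.X_dvd hh, comp_assoc i hg hkh]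
      _ = comp f (comp i (comp k h)) := by
          rw [comp_eq_comp_of_inverse hf hh hi hhi hih hfg, comp_assoc _ hi hkh]

theorem formalCentralizer_eq_image (hf : X ∣ f) (hg : X ∣ g) (hh : X ∣ h) (hi : X ∣ i)
    (hhi : comp h i = X) (hih : comp i h = X) (hfg : comp h f = comp g h) :
    formalCentralizer f = (fun k => comp i (comp k h)) '' formalCentralizer g := by
  refine Set.Subset.antisymm (fun l hl => ?_) (Set.image_subset_iff.mpr fun k hk =>
    comp_comp_mem_formalCentralizer hf hg hh hi hhi hih hfg hk)
  have hli := X_dvd_comp hl.1.X_dvd hi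
  refine ⟨comp h (comp l i), comp_comp_mem_formalCentralizer hg hf hi hh hih hhi
    (comp_eq_comp_of_inverse hf hh hi hhi hih hfg) hl, ?_⟩
  calc comp i (comp (comp h (comp l i)) h) = comp (comp i h) (comp l (comp i h)) := by
        rw [comp_assoc h hli hh, comp_assoc l hi hh,
          comp_assoc i hh (X_dvd_comp hl.1.X_dvd (X_dvd_comp hi hh))]
    _ = l := by rw [hih, comp_X, X_comp hl.1.X_dvd]

end Transport

theorem formalCentralizer_eq_of_comp_timeMap [CharZero K] {V f h : K⟦X⟧} {q : ℕ} (hq : q ≠ 0)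
    (hV : X ^ (q + 1) ∣ V) (hV0 : coeff (q + 1) V ≠ 0) (hf : X ∣ f) (hh : X ∣ h)
    (h1 : coeff 1 h ≠ 0) (hcomp : comp h f = comp (timeMap V 1) h) :
    formalCentralizer f = {g | ∃ t : K, g = comp (compInv h h1) (comp (timeMap V t) h)} := by
  have hg := X_dvd_timeMap (X_sq_dvd_of_X_pow_succ_dvd hq hV) 1
  have h0 := X_dvd_iff.mp hh
  rw [formalCentralizer_eq_image hf hg hh (X_dvd_compInv h h1) (comp_compInv h h0 h1)
    (compInv_comp h h0 h1) hcomp, formalCentralizer_timeMap_one hq hV hV0, ← Set.range_comp]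
  ext g
  exact exists_congr fun t => eq_comm

end Centralizers

section Convergence

variable {K : Type*} [NontriviallyNormedField K] {f : K⟦X⟧}

theorem isLocallyAnalytic_of_norm_coeff_le {r B : ℝ} (hr : 0 < r)
    (h : ∀ n, ‖coeff n f‖ ≤ B * r ^ n) : IsLocallyAnalytic f := by
  have hr' : 0 < r.toNNReal⁻¹ := by simpa using hr
  refine lt_of_lt_of_le (ENNReal.coe_pos.mpr hr')
    (FormalMultilinearSeries.le_radius_of_bound _ B fun n => ?_)
  rw [FormalMultilinearSeries.ofScalars_norm, NNReal.coe_inv, Real.coe_toNNReal r hr.le, inv_pow,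
    ← div_eq_mul_inv, div_le_iff₀ (pow_pos hr n)]
  exact h n

theorem isLocallyAnalytic_of_norm_coeff_succ_le {r B : ℝ} (hr : 0 < r)
    (h : ∀ n, ‖coeff (n + 1) f‖ ≤ B * r ^ n) : IsLocallyAnalytic f := by
  refine isLocallyAnalytic_of_norm_coeff_le (B := max ‖coeff 0 f‖ (B / r)) hr fun n => ?_
  cases n with
  | zero => simp
  | succ n =>
    calc ‖coeff (n + 1) f‖ ≤ B / r * r ^ (n + 1) := by
          rw [pow_succ', ← mul_assoc, div_mul_cancel₀ _ hr.ne']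
          exact h n
      _ ≤ max ‖coeff 0 f‖ (B / r) * r ^ (n + 1) := by
          gcongr
          exact le_max_right _ _

theorem IsLocallyAnalytic.exists_norm_coeff_succ_le_pow (hf : IsLocallyAnalytic f)
    (hf1 : ‖coeff 1 f‖ ≤ 1) : ∃ R : ℝ, 1 ≤ R ∧ ∀ n, ‖coeff (n + 1) f‖ ≤ R ^ n := by
  obtain ⟨B, r, hB, hr, h⟩ := FormalMultilinearSeries.le_mul_pow_of_radius_pos _ hf
  simp only [FormalMultilinearSeries.ofScalars_norm] at h
  refine ⟨max (B * r) 1 * max r 1,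
    one_le_mul_of_one_le_of_one_le (le_max_right _ _) (le_max_right _ _), fun n => ?_⟩
  obtain rfl | hn := eq_or_ne n 0
  · simpa using hf1
  · calc ‖coeff (n + 1) f‖ ≤ B * r * r ^ n := by
          rw [mul_assoc, ← pow_succ']
          exact h (n + 1)
      _ ≤ max (B * r) 1 ^ n * max r 1 ^ n := by
          gcongr
          · exact (le_max_left _ _).trans (le_self_pow₀ (le_max_right _ _) hn)
          · exact le_max_left _ _
      _ = (max (B * r) 1 * max r 1) ^ n := (mul_pow _ _ _).symm

end Convergence

section NaturalNumbers

open scoped Nat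

variable {K : Type*} [NormedField K]

theorem norm_factorial_pos [CharZero K] (n : ℕ) : 0 < ‖((n)! : K)‖ :=
  norm_pos_iff.mpr (Nat.cast_ne_zero.mpr n.factorial_ne_zero)

theorem norm_natCast_eq_one_of_forall_prime (h : ∀ p : ℕ, p.Prime → ‖(p : K)‖ = 1) {n : ℕ}
    (hn : n ≠ 0) : ‖(n : K)‖ = 1 := by
  induction n using Nat.recOnMul with
  | zero => exact absurd rfl hn
  | one => rw [Nat.cast_one, norm_one]
  | prime p hp => exact h p hp
  | mul a b ha hb =>
    rw [Nat.cast_mul, norm_mul, ha (left_ne_zero_of_mul hn), hb (right_ne_zero_of_mul hn), one_mul]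

variable [IsUltrametricDist K]

theorem norm_natCast_le_of_dvd {a b : ℕ} (h : a ∣ b) : ‖(b : K)‖ ≤ ‖(a : K)‖ := by
  obtain ⟨c, rfl⟩ := h
  rw [Nat.cast_mul, norm_mul]
  exact mul_le_of_le_one_right (norm_nonneg _) (IsUltrametricDist.norm_natCast_le_one K c)

theorem norm_intCast_mul_lt_one (a : ℤ) {x : K} (hx : ‖x‖ < 1) : ‖a * x‖ < 1 := by
  rw [norm_mul]
  exact (mul_le_of_le_one_left (norm_nonneg _) (IsUltrametricDist.norm_intCast_le_one K a)).trans_lt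
    hx

theorem norm_natCast_eq_one_of_coprime {m n : ℕ} (hmn : m.Coprime n) (hm : ‖(m : K)‖ < 1) :
    ‖(n : K)‖ = 1 := by
  refine (IsUltrametricDist.norm_natCast_le_one K n).antisymm (le_of_not_gt fun hn => ?_)
  obtain ⟨a, b, hab⟩ := Nat.isCoprime_iff_coprime.mpr hmn
  have hab' : (a * m + b * n : K) = 1 := by exact_mod_cast congrArg (Int.cast (R := K)) hab
  have hlt : ‖(a * m + b * n : K)‖ < 1 := (IsUltrametricDist.norm_add_le_max _ _).trans_lt
    (max_lt (norm_intCast_mul_lt_one a hm) (norm_intCast_mul_lt_one b hn))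
  rw [hab', norm_one] at hlt
  exact lt_irrefl _ hlt

theorem norm_natCast_eq_norm_prime_pow {p : ℕ} (hp : p.Prime) (hp1 : ‖(p : K)‖ < 1) {n : ℕ}
    (hn : n ≠ 0) : ‖(n : K)‖ = ‖(p : K)‖ ^ padicValNat p n := by
  have hcop : p.Coprime (n / p ^ n.factorization p) := Nat.coprime_ordCompl hp hn
  conv_lhs => rw [← Nat.ordProj_mul_ordCompl_eq_self n p]
  rw [Nat.cast_mul, norm_mul, norm_natCast_eq_one_of_coprime hcop hp1, mul_one, Nat.cast_pow,
    norm_pow, Nat.factorization_def n hp]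

/-- If some prime `p` has norm less than `1`, then `‖n!‖` is `‖p‖` to the power of the `p`-adic
valuation of `n!`, which is at most `n`; otherwise all factorials have norm `1`. -/
theorem exists_inv_norm_factorial_le [CharZero K] :
    ∃ B : ℝ, 1 ≤ B ∧ ∀ n : ℕ, ‖((n)! : K)‖⁻¹ ≤ B ^ n := by
  by_cases h : ∃ p : ℕ, p.Prime ∧ ‖(p : K)‖ < 1
  · obtain ⟨p, hp, hp1⟩ := h
    have : Fact p.Prime := ⟨hp⟩
    have hB : 1 ≤ ‖(p : K)‖⁻¹ :=
      (one_le_inv₀ (norm_pos_iff.mpr (Nat.cast_ne_zero.mpr hp.ne_zero))).mpr hp1.le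
    refine ⟨‖(p : K)‖⁻¹, hB, fun n => ?_⟩
    rw [norm_natCast_eq_norm_prime_pow hp hp1 n.factorial_ne_zero, ← inv_pow]
    exact pow_le_pow_right₀ hB (padicValNat_factorial_le p n)
  · push Not at h
    refine ⟨1, le_rfl, fun n => ?_⟩
    rw [norm_natCast_eq_one_of_forall_prime (fun p hp =>
      (IsUltrametricDist.norm_natCast_le_one K p).antisymm (h p hp)) n.factorial_ne_zero, inv_one,
      one_pow]

end NaturalNumbers

section Majorants

open scoped Nat

variable {K : Type*} [NormedField K] [IsUltrametricDist K]

theorem norm_coeff_pow_le {w : K⟦X⟧} {R : ℝ} (hw : ∀ n, ‖coeff n w‖ ≤ R ^ n) (d n : ℕ) :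
    ‖coeff n (w ^ d)‖ ≤ R ^ n := by
  rw [coeff_pow]
  refine IsUltrametricDist.norm_sum_le_of_forall_le_of_nonneg ((norm_nonneg _).trans (hw n))
    fun l hl => ?_
  calc ‖∏ i ∈ Finset.range d, coeff (l i) w‖ ≤ ∏ i ∈ Finset.range d, R ^ l i := by
        rw [norm_prod]
        exact Finset.prod_le_prod (fun _ _ => norm_nonneg _) fun i _ => hw (l i)
    _ = R ^ n := by rw [Finset.prod_pow_eq_pow_sum, (Finset.mem_finsuppAntidiag.mp hl).1]

theorem norm_coeff_inv_le {f : K⟦X⟧} (hf : constantCoeff f = 1) {R : ℝ}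
    (hR : ∀ n, ‖coeff n f‖ ≤ R ^ n) (n : ℕ) : ‖coeff n f⁻¹‖ ≤ R ^ n := by
  induction n using Nat.strong_induction_on with
  | _ n ih =>
  have hRn : 0 ≤ R ^ n := (norm_nonneg _).trans (hR n)
  rw [PowerSeries.coeff_inv, hf, inv_one]
  split_ifs with hn
  · rw [hn, pow_zero, norm_one]
  · rw [neg_mul, one_mul, norm_neg]
    refine IsUltrametricDist.norm_sum_le_of_forall_le_of_nonneg hRn fun x hx => ?_
    split_ifs with hxn
    · rw [norm_mul, ← Finset.HasAntidiagonal.mem_antidiagonal.mp hx, pow_add]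
      exact mul_le_mul (hR _) (ih _ hxn) (norm_nonneg _) ((norm_nonneg _).trans (hR _))
    · rwa [norm_zero]

theorem sum_tsub_le_sum_tsub_one {ι : Type*} (s : Finset ι) (l : ι → ℕ) {q : ℕ} (hq : q ≠ 0) :
    ∑ i ∈ s, (l i - q) ≤ ∑ i ∈ s, l i - 1 := by
  classical
  induction s using Finset.induction_on with
  | empty => simp
  | insert a s ha ih => rw [Finset.sum_insert ha, Finset.sum_insert ha]; omega

theorem sum_tsub_le {ι : Type*} {s : Finset ι} {l : ι → ℕ} {q p : ℕ} (hq : q ≠ 0)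
    (hl : ∀ i ∈ s, l i ≤ q + p) (hs : ∑ i ∈ s, l i ≤ q + 1 + p) :
    ∑ i ∈ s, (l i - q) ≤ p := by
  classical
  by_cases h : ∃ a ∈ s, q < l a
  · obtain ⟨a, ha, haq⟩ := h
    have hla := hl a ha
    have hrest := sum_tsub_le_sum_tsub_one (s.erase a) l hq
    rw [← Finset.add_sum_erase s _ ha] at hs ⊢
    omega
  · push Not at h
    rw [Finset.sum_eq_zero fun i hi => Nat.sub_eq_zero_of_le (h i hi)]
    exact Nat.zero_le p

/-- The small divisors collected in one term of `w ^ d` are factorials whose product divides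
`p!`. -/
theorem norm_coeff_pow_mul_factorial_le {w : K⟦X⟧} {q p : ℕ} (hq : q ≠ 0) {M S : ℝ} (hS : 0 ≤ S)
    (hw : ∀ i ≤ q + p, ‖coeff i w‖ * ‖((i - q)! : K)‖ ≤ M * S ^ i)
    (hw0 : ∀ i, q + p < i → coeff i w = 0) (d : ℕ) {n : ℕ} (hn : n ≤ q + 1 + p) :
    ‖coeff n (w ^ d)‖ * ‖((p)! : K)‖ ≤ M ^ d * S ^ n := by
  have hM : 0 ≤ M := by
    have := (mul_nonneg (norm_nonneg _) (norm_nonneg _)).trans (hw 0 (Nat.zero_le _))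
    rwa [pow_zero, mul_one] at this
  have hnonneg : 0 ≤ M ^ d * S ^ n := by positivity
  rw [coeff_pow, ← norm_mul, Finset.sum_mul]
  refine IsUltrametricDist.norm_sum_le_of_forall_le_of_nonneg hnonneg fun l hl => ?_
  obtain ⟨hl, -⟩ := Finset.mem_finsuppAntidiag.mp hl
  rw [norm_mul, norm_prod]
  by_cases hbig : ∃ i ∈ Finset.range d, q + p < l i
  · obtain ⟨i, hi, hil⟩ := hbig
    rwa [Finset.prod_eq_zero hi (by rw [hw0 _ hil, norm_zero]), zero_mul]
  · push Not at hbig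
    have hdvd : ∏ i ∈ Finset.range d, (l i - q)! ∣ (p)! :=
      (Nat.prod_factorial_dvd_factorial_sum _ _).trans
        (Nat.factorial_dvd_factorial (sum_tsub_le hq hbig (hl.trans_le hn)))
    calc (∏ i ∈ Finset.range d, ‖coeff (l i) w‖) * ‖((p)! : K)‖
        ≤ (∏ i ∈ Finset.range d, ‖coeff (l i) w‖) *
          ‖((∏ i ∈ Finset.range d, (l i - q)! : ℕ) : K)‖ := by
          gcongr
          exact norm_natCast_le_of_dvd hdvd
      _ = ∏ i ∈ Finset.range d, (‖coeff (l i) w‖ * ‖((l i - q)! : K)‖) := by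
          rw [Nat.cast_prod, norm_prod, Finset.prod_mul_distrib]
      _ ≤ ∏ i ∈ Finset.range d, M * S ^ l i :=
          Finset.prod_le_prod (fun _ _ => by positivity) fun i hi => hw _ (hbig i hi)
      _ = M ^ d * S ^ n := by
          rw [Finset.prod_mul_distrib, Finset.prod_const, Finset.card_range,
            Finset.prod_pow_eq_pow_sum, hl]

end Majorants

section MainEstimate

open scoped Nat

variable {K : Type*} [NormedField K] [IsUltrametricDist K] {u : K⟦X⟧} {q p : ℕ} {M S A : ℝ}

theorem norm_coeff_comp_left_mul_factorial_le {f : K⟦X⟧} (hu : X ∣ u) (hf : X ∣ f)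
    {R : ℝ} (hfR : ∀ n, ‖coeff (n + 1) f‖ ≤ R ^ n)
    (hRS : ∀ k, q < k → R ^ k ≤ A * S ^ (k - q))
    (hu_le : ∀ k ≤ q + p, ‖coeff (k + 1) u‖ * ‖((k - q)! : K)‖ ≤ M * S ^ k)
    (hu_zero : ∀ k, q + p < k → coeff (k + 1) u = 0) :
    ‖coeff (2 * q + 2 + p) (comp u f)‖ * ‖((p)! : K)‖ ≤ M * A * S ^ (q + 1 + p) := by
  obtain ⟨w, rfl⟩ := hf
  have hterm (k : ℕ) (hk : k ≤ q + p) :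
      ‖coeff (k + 1) u‖ * ‖coeff (2 * q + 2 + p) ((X * w) ^ (k + 1))‖ * ‖((p)! : K)‖ ≤
        M * A * S ^ (q + 1 + p) := by
    have hcoeff : ‖coeff (k + 1) u‖ * ‖((p)! : K)‖ ≤ M * S ^ k := by
      refine le_trans ?_ (hu_le k hk)
      gcongr
      exact norm_natCast_le_of_dvd (Nat.factorial_dvd_factorial (by omega))
    have hpow : ‖coeff (2 * q + 2 + p) ((X * w) ^ (k + 1))‖ ≤ A * S ^ (q + 1 + p - k) := by
      rw [coeff_X_mul_pow w (by omega)]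
      refine (norm_coeff_pow_le (fun n => ?_) _ _).trans ((hRS _ (by omega)).trans_eq ?_)
      · simpa only [coeff_succ_X_mul] using hfR n
      · rw [show 2 * q + 2 + p - (k + 1) - q = q + 1 + p - k by omega]
    calc _ = ‖coeff (k + 1) u‖ * ‖((p)! : K)‖ *
          ‖coeff (2 * q + 2 + p) ((X * w) ^ (k + 1))‖ := by ring
      _ ≤ M * S ^ k * (A * S ^ (q + 1 + p - k)) :=
          mul_le_mul hcoeff hpow (norm_nonneg _) ((by positivity : (0 : ℝ) ≤ _).trans hcoeff)
      _ = M * A * S ^ (q + 1 + p) := by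
          rw [← pow_mul_pow_sub S (show k ≤ q + 1 + p by omega)]; ring
  have hnonneg : 0 ≤ M * A * S ^ (q + 1 + p) :=
    (by positivity : (0 : ℝ) ≤ _).trans (hterm 0 (Nat.zero_le _))
  rw [comp, coeff_subst_eq_sum u (dvd_mul_right X w) (Nat.lt_succ_self _), ← norm_mul,
    Finset.sum_mul]
  refine IsUltrametricDist.norm_sum_le_of_forall_le_of_nonneg hnonneg fun d _ => ?_
  rw [smul_eq_mul, norm_mul, norm_mul]
  obtain _ | k := d
  · rwa [coeff_zero_eq_constantCoeff_apply, X_dvd_iff.mp hu, norm_zero, zero_mul, zero_mul]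
  obtain hk | hk := le_or_gt k (q + p)
  · exact hterm k hk
  · rwa [hu_zero k hk, norm_zero, zero_mul, zero_mul]

theorem norm_coeff_comp_right_mul_factorial_le {g : K⟦X⟧} (hq : q ≠ 0) (hu : X ∣ u)
    (hg : X ^ (q + 1) ∣ g - X) (hS : 0 ≤ S)
    (hgS : ∀ k, q ≤ k → ‖coeff (k + 1) g‖ * M ^ k ≤ A * S ^ (k - q))
    (hu_le : ∀ k ≤ q + p, ‖coeff (k + 1) u‖ * ‖((k - q)! : K)‖ ≤ M * S ^ k)
    (hu_zero : ∀ k, q + p < k → coeff (k + 1) u = 0) :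
    ‖coeff (2 * q + 2 + p) (comp g u)‖ * ‖((p)! : K)‖ ≤ M * A * S ^ (q + 1 + p) := by
  have hM : 0 ≤ M := by
    simpa using (mul_nonneg (norm_nonneg _) (norm_nonneg _)).trans (hu_le 0 (Nat.zero_le _))
  obtain ⟨w, rfl⟩ := hu
  simp only [coeff_succ_X_mul] at hu_le hu_zero
  have hterm (k : ℕ) (hqk : q ≤ k) (hk : k ≤ 2 * q + 1 + p) :
      ‖coeff (k + 1) g‖ * (‖coeff (2 * q + 2 + p) ((X * w) ^ (k + 1))‖ * ‖((p)! : K)‖) ≤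
        M * A * S ^ (q + 1 + p) := by
    rw [coeff_X_mul_pow w (by omega)]
    calc _ ≤ ‖coeff (k + 1) g‖ * (M ^ (k + 1) * S ^ (2 * q + 2 + p - (k + 1))) := by
          refine mul_le_mul_of_nonneg_left ?_ (norm_nonneg _)
          exact norm_coeff_pow_mul_factorial_le hq hS hu_le hu_zero _ (by omega)
      _ = M * (‖coeff (k + 1) g‖ * M ^ k) * S ^ (2 * q + 2 + p - (k + 1)) := by ring
      _ ≤ M * (A * S ^ (k - q)) * S ^ (2 * q + 2 + p - (k + 1)) := by
          gcongr ?_ * _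
          exact mul_le_mul_of_nonneg_left (hgS k hqk) hM
      _ = M * A * S ^ (q + 1 + p) := by
          rw [show q + 1 + p = (k - q) + (2 * q + 2 + p - (k + 1)) by omega]; ring
  have hnonneg : 0 ≤ M * A * S ^ (q + 1 + p) :=
    (by positivity : (0 : ℝ) ≤ _).trans (hterm q le_rfl (by omega))
  rw [comp, coeff_subst_eq_sum g (dvd_mul_right X w) (Nat.lt_succ_self _), ← norm_mul,
    Finset.sum_mul]
  refine IsUltrametricDist.norm_sum_le_of_forall_le_of_nonneg hnonneg fun d hd => ?_
  have hdN := Finset.mem_range.mp hd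
  rw [smul_eq_mul, norm_mul, norm_mul, mul_assoc]
  obtain hdq | hdq := le_or_gt d q
  · rw [coeff_eq_of_X_pow_dvd_sub hg (by omega), coeff_X]
    split_ifs with hd1
    · rwa [hd1, pow_one, show 2 * q + 2 + p = 2 * q + 1 + p + 1 by omega, coeff_succ_X_mul,
        hu_zero _ (by omega), norm_zero, zero_mul, mul_zero]
    · rwa [norm_zero, zero_mul]
  · obtain ⟨k, rfl⟩ : ∃ k, d = k + 1 := ⟨d - 1, by omega⟩
    exact hterm k (by omega) (by omega)

end MainEstimate

section Convergence

open scoped Nat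

variable {K : Type*}

theorem norm_coeff_succ_mul_factorial_le [NormedField K] [IsUltrametricDist K] {f g h : K⟦X⟧}
    {q : ℕ} (hq : q ≠ 0) (hf : X ^ (q + 1) ∣ f - X) (hf0 : coeff (q + 1) f ≠ 0)
    (hg : X ^ (q + 1) ∣ g - X) (hfg : coeff (q + 1) f = coeff 1 h ^ q * coeff (q + 1) g)
    (hh : X ∣ h) (hcomp : comp h f = comp g h) {R S : ℝ} (hS : 0 ≤ S)
    (hfR : ∀ n, ‖coeff (n + 1) f‖ ≤ R ^ n)
    (hRS : ∀ k, q < k → R ^ k ≤ ‖coeff (q + 1) f‖ * S ^ (k - q))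
    (hgS : ∀ k, q ≤ k →
      ‖coeff (k + 1) g‖ * ‖coeff 1 h‖ ^ k ≤ ‖coeff (q + 1) f‖ * S ^ (k - q))
    (hhS : ∀ k ≤ q, ‖coeff (k + 1) h‖ ≤ ‖coeff 1 h‖ * S ^ k) (k : ℕ) :
    ‖coeff (k + 1) h‖ * ‖((k - q)! : K)‖ ≤ ‖coeff 1 h‖ * S ^ k := by
  induction k using Nat.strong_induction_on with
  | _ k ih =>
  obtain hkq | hqk := le_or_gt k q
  · rw [Nat.sub_eq_zero_of_le hkq, Nat.factorial_zero, Nat.cast_one, norm_one, mul_one]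
    exact hhS k hkq
  obtain ⟨p, rfl⟩ : ∃ p, k = q + 1 + p := ⟨k - (q + 1), by omega⟩
  set u : K⟦X⟧ := ↑(trunc (q + 2 + p) h) with hu
  have hcoeff (i : ℕ) : coeff i u = if i < q + 2 + p then coeff i h else 0 := by
    rw [hu, Polynomial.coeff_coe, coeff_trunc]
  have hu0 : X ∣ u := by
    rw [X_dvd_iff, ← coeff_zero_eq_constantCoeff_apply, hcoeff, if_pos (by omega),
      coeff_zero_eq_constantCoeff_apply, X_dvd_iff.mp hh]
  have hu_le (i : ℕ) (hi : i ≤ q + p) :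
      ‖coeff (i + 1) u‖ * ‖((i - q)! : K)‖ ≤ ‖coeff 1 h‖ * S ^ i := by
    rw [hcoeff, if_pos (by omega)]
    exact ih i (by omega)
  have hu_zero (i : ℕ) (hi : q + p < i) : coeff (i + 1) u = 0 := by
    rw [hcoeff, if_neg (by omega)]
  have hdefect : ‖coeff (2 * q + 2 + p) (defect f g u)‖ * ‖((p)! : K)‖ ≤
      ‖coeff 1 h‖ * ‖coeff (q + 1) f‖ * S ^ (q + 1 + p) := by
    rw [defect, map_sub]
    have hmax := IsUltrametricDist.norm_add_le_max (coeff (2 * q + 2 + p) (comp u f))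
      (-coeff (2 * q + 2 + p) (comp g u))
    rw [norm_neg, ← sub_eq_add_neg] at hmax
    refine (mul_le_mul_of_nonneg_right hmax (norm_nonneg _)).trans ?_
    rw [max_mul_of_nonneg _ _ (norm_nonneg _)]
    exact max_le
      (norm_coeff_comp_left_mul_factorial_le hu0 (X_dvd_of_X_pow_dvd_sub_X hf) hfR hRS hu_le
        hu_zero)
      (norm_coeff_comp_right_mul_factorial_le hq hu0 hg hS hgS hu_le hu_zero)
  have hfactorial : ((q + 1 + p - q)! : K) = (p + 1) * (p)! := by
    rw [show q + 1 + p - q = p + 1 by omega, Nat.factorial_succ, Nat.cast_mul, Nat.cast_succ]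
  rw [coeff_defect_trunc hq hf hg hfg hh hcomp, norm_neg, norm_mul, norm_mul] at hdefect
  refine le_of_mul_le_mul_left ?_ (norm_pos_iff.mpr hf0)
  rw [hfactorial, norm_mul, show q + 1 + p + 1 = q + 2 + p by omega]
  linarith

theorem exists_one_le_forall_norm_le_mul_pow [NormedField K] (a : ℕ → K) (ha : a 0 ≠ 0) (q : ℕ) :
    ∃ S : ℝ, 1 ≤ S ∧ ∀ k ≤ q, ‖a k‖ ≤ ‖a 0‖ * S ^ k := by
  induction q with
  | zero => exact ⟨1, le_rfl, fun k hk => by rw [Nat.le_zero.mp hk, pow_zero, mul_one]⟩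
  | succ q ih =>
    obtain ⟨S, hS, hle⟩ := ih
    have ha0 : 0 < ‖a 0‖ := norm_pos_iff.mpr ha
    refine ⟨max S (‖a (q + 1)‖ / ‖a 0‖), le_max_of_le_left hS, fun k hk => ?_⟩
    obtain hk | rfl := hk.lt_or_eq
    · refine (hle k (Nat.lt_succ_iff.mp hk)).trans ?_
      gcongr
      exact le_max_left _ _
    · rw [← div_le_iff₀' ha0]
      exact (le_max_right _ _).trans (le_self_pow₀ (le_max_of_le_left hS) q.succ_ne_zero)

theorem pow_le_mul_pow_sub {R S A : ℝ} {q k : ℕ} (hR : 0 ≤ R) (hRS : R ≤ S)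
    (hA : R ^ (q + 1) ≤ A * S) (hqk : q < k) : R ^ k ≤ A * S ^ (k - q) := by
  obtain ⟨n, rfl⟩ : ∃ n, k = q + 1 + n := ⟨k - (q + 1), by omega⟩
  have hAS : 0 ≤ A * S := (pow_nonneg hR _).trans hA
  calc R ^ (q + 1 + n) = R ^ (q + 1) * R ^ n := pow_add _ _ _
    _ ≤ A * S * S ^ n := by gcongr
    _ = A * S ^ (q + 1 + n - q) := by rw [show q + 1 + n - q = n + 1 by omega]; ring

variable [NontriviallyNormedField K] [IsUltrametricDist K] [CharZero K]

theorem isLocallyAnalytic_of_norm_coeff_succ_mul_factorial_le {h : K⟦X⟧} {q : ℕ} {M S : ℝ}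
    (hS : 0 < S) (hle : ∀ k, ‖coeff (k + 1) h‖ * ‖((k - q)! : K)‖ ≤ M * S ^ k) :
    IsLocallyAnalytic h := by
  obtain ⟨B, hB, hfactorial⟩ := exists_inv_norm_factorial_le (K := K)
  refine isLocallyAnalytic_of_norm_coeff_succ_le (B := M) (r := S * B) (by positivity)
    fun k => ?_
  have hMS : 0 ≤ M * S ^ k := (by positivity : (0 : ℝ) ≤ _).trans (hle k)
  calc ‖coeff (k + 1) h‖ ≤ M * S ^ k * ‖((k - q)! : K)‖⁻¹ :=
        (le_mul_inv_iff₀ (norm_factorial_pos _)).mpr (hle k)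
    _ ≤ M * S ^ k * B ^ k := by
        gcongr
        exact (hfactorial _).trans (pow_le_pow_right₀ hB (Nat.sub_le _ _))
    _ = M * (S * B) ^ k := by rw [mul_pow, mul_assoc]

theorem isLocallyAnalytic_of_comp_eq_comp {f g h : K⟦X⟧} {q : ℕ} (hq : q ≠ 0)
    (hfa : IsLocallyAnalytic f) (hga : IsLocallyAnalytic g) (hf : X ∣ f)
    (hg : X ^ (q + 1) ∣ g - X) (hg0 : coeff (q + 1) g ≠ 0) (hh : X ∣ h) (hh1 : coeff 1 h ≠ 0)
    (hcomp : comp h f = comp g h) : IsLocallyAnalytic h := by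
  have hfX := X_pow_dvd_sub_X_of_comp_eq_comp hf hg hh hh1 hcomp
  have hfg := coeff_succ_of_comp_eq_comp hq hf hg hh hh1 hcomp
  have hf0 : coeff (q + 1) f ≠ 0 := hfg ▸ mul_ne_zero (pow_ne_zero _ hh1) hg0
  have hα : 0 < ‖coeff (q + 1) f‖ := norm_pos_iff.mpr hf0
  obtain ⟨R₁, hR₁, hfR⟩ := hfa.exists_norm_coeff_succ_le_pow
    (by rw [coeff_one_of_X_pow_dvd_sub_X hq hfX, norm_one])
  obtain ⟨R₂, hR₂, hgR⟩ := hga.exists_norm_coeff_succ_le_pow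
    (by rw [coeff_one_of_X_pow_dvd_sub_X hq hg, norm_one])
  obtain ⟨S₀, hS₀, hhS⟩ := exists_one_le_forall_norm_le_mul_pow (fun k => coeff (k + 1) h) hh1 q
  set R := max R₁ (R₂ * ‖coeff 1 h‖)
  set S := max (max R S₀) (R ^ (q + 1) / ‖coeff (q + 1) f‖)
  have hR : 0 ≤ R := zero_le_one.trans (hR₁.trans (le_max_left _ _))
  have hS : 0 < S :=
    zero_lt_one.trans_le (hS₀.trans ((le_max_right _ _).trans (le_max_left _ _)))
  have hRS (k : ℕ) (hk : q < k) : R ^ k ≤ ‖coeff (q + 1) f‖ * S ^ (k - q) :=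
    pow_le_mul_pow_sub hR ((le_max_left _ _).trans (le_max_left _ _))
      ((div_le_iff₀' hα).mp (le_max_right _ _)) hk
  have hgS (k : ℕ) (hk : q ≤ k) :
      ‖coeff (k + 1) g‖ * ‖coeff 1 h‖ ^ k ≤ ‖coeff (q + 1) f‖ * S ^ (k - q) := by
    obtain rfl | hk := hk.eq_or_lt
    · rw [hfg, norm_mul, norm_pow, Nat.sub_self, pow_zero, mul_one, mul_comm]
    · refine le_trans ?_ (hRS k hk)
      calc _ ≤ R₂ ^ k * ‖coeff 1 h‖ ^ k := by gcongr; exact hgR k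
        _ = (R₂ * ‖coeff 1 h‖) ^ k := (mul_pow _ _ _).symm
        _ ≤ R ^ k := by gcongr; exact le_max_right _ _
  have hhS' (k : ℕ) (hk : k ≤ q) : ‖coeff (k + 1) h‖ ≤ ‖coeff 1 h‖ * S ^ k :=
    (hhS k hk).trans (by gcongr; exact (le_max_right _ _).trans (le_max_left _ _))
  exact isLocallyAnalytic_of_norm_coeff_succ_mul_factorial_le hS
    (norm_coeff_succ_mul_factorial_le hq hfX hf0 hg hfg hh hcomp hS.le
      (fun n => (hfR n).trans (pow_le_pow_left₀ (by positivity) (le_max_left _ _) n))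
      hRS hgS hhS')

end Convergence

section FlowConvergence

open scoped Nat NNReal

theorem coeff_pow_mem_of_forall_le {A S : Type*} [CommRing A] [SetLike S A]
    [AddSubmonoidClass S A] (F : ℕ → S) [SetLike.GradedMonoid F] {w : A⟦X⟧} {n : ℕ}
    (hw : ∀ i ≤ n, coeff i w ∈ F i) (d : ℕ) : coeff n (w ^ d) ∈ F n := by
  rw [coeff_pow]
  refine sum_mem fun l hl => ?_
  obtain ⟨hl, -⟩ := Finset.mem_finsuppAntidiag.mp hl
  have hle (i : ℕ) (hi : i ∈ Finset.range d) : l i ≤ n :=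
    (Finset.single_le_sum (f := l) (fun _ _ => Nat.zero_le _) hi).trans_eq hl
  rw [← hl]
  exact SetLike.prod_mem_graded F l _ fun i hi => hw _ (hle i hi)

section NormedField

/-- The polynomials `∑ i ≤ n, aᵢ tⁱ / i!` with `‖aᵢ‖ ≤ r`. Unlike bounds on the coefficients
themselves, these bounds are not affected by integration. -/
def dividedPowerBall (K : Type*) [NormedField K] [IsUltrametricDist K] (n : ℕ) (r : ℝ≥0) :
    AddSubmonoid (Polynomial K) where
  carrier := {p | ∀ i, ‖((i)! : K) * p.coeff i‖ ≤ r ∧ (n < i → p.coeff i = 0)}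
  zero_mem' i := by simp
  add_mem' ha hb i := by
    refine ⟨?_, fun hi => ?_⟩
    · rw [Polynomial.coeff_add, mul_add]
      exact (IsUltrametricDist.norm_add_le_max _ _).trans (max_le (ha i).1 (hb i).1)
    · rw [Polynomial.coeff_add, (ha i).2 hi, (hb i).2 hi, add_zero]

variable {K : Type*} [NormedField K] [IsUltrametricDist K]
  {m n : ℕ} {r s : ℝ≥0} {a b : Polynomial K}

theorem dividedPowerBall_mono (hmn : m ≤ n) : dividedPowerBall K m r ≤ dividedPowerBall K n r :=
  fun _ ha i => ⟨(ha i).1, fun hi => (ha i).2 (hmn.trans_lt hi)⟩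

theorem one_mem_dividedPowerBall : 1 ∈ dividedPowerBall K 0 1 := fun i => by
  obtain rfl | hi := eq_or_ne i 0
  · simp
  · simp [Polynomial.coeff_one, hi]

theorem smul_mem_dividedPowerBall {c : K} (hc : ‖c‖ ≤ s) (ha : a ∈ dividedPowerBall K n r) :
    c • a ∈ dividedPowerBall K n (s * r) := fun i => by
  rw [Polynomial.coeff_smul, smul_eq_mul, mul_left_comm, norm_mul, NNReal.coe_mul]
  exact ⟨mul_le_mul hc (ha i).1 (norm_nonneg _) s.2, fun hi => by rw [(ha i).2 hi, mul_zero]⟩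

theorem mul_mem_dividedPowerBall (ha : a ∈ dividedPowerBall K m r)
    (hb : b ∈ dividedPowerBall K n s) : a * b ∈ dividedPowerBall K (m + n) (r * s) := by
  intro i
  rw [Polynomial.coeff_mul]
  refine ⟨?_, fun hi => Finset.sum_eq_zero fun x hx => ?_⟩
  · rw [Finset.mul_sum]
    refine IsUltrametricDist.norm_sum_le_of_forall_le_of_nonneg (r * s).2 fun x hx => ?_
    rw [← Finset.HasAntidiagonal.mem_antidiagonal.mp hx]
    have hchoose : ((x.1 + x.2)! : K) * (a.coeff x.1 * b.coeff x.2) =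
        ((x.1 + x.2).choose x.2 : K) *
          (((x.1)! * a.coeff x.1) * ((x.2)! * b.coeff x.2)) := by
      rw [← Nat.add_choose_mul_factorial_mul_factorial]
      push_cast
      ring
    rw [hchoose, norm_mul, norm_mul (_ * _)]
    exact (mul_le_of_le_one_left (by positivity)
      (IsUltrametricDist.norm_natCast_le_one K _)).trans
      (mul_le_mul (ha _).1 (hb _).1 (norm_nonneg _) r.2)
  · have hx := Finset.HasAntidiagonal.mem_antidiagonal.mp hx
    obtain h | h := lt_or_ge m x.1
    · rw [(ha _).2 h, zero_mul]
    · rw [(hb _).2 (by omega), mul_zero]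

instance gradedMonoid_dividedPowerBall (r : ℝ≥0) :
    SetLike.GradedMonoid fun n => dividedPowerBall K n (r ^ n) where
  one_mem := by simpa only [pow_zero] using one_mem_dividedPowerBall
  mul_mem i j a b ha hb := by simpa only [pow_add] using mul_mem_dividedPowerBall ha hb

variable [CharZero K]

theorem mem_dividedPowerBall_of_derivative_mem (h0 : a.coeff 0 = 0)
    (ha : Polynomial.derivative a ∈ dividedPowerBall K n r) :
    a ∈ dividedPowerBall K (n + 1) r := by
  rintro (_ | i)
  · simp [h0]
  · have hi := ha i
    rw [Polynomial.coeff_derivative] at hi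
    rw [Nat.factorial_succ, Nat.cast_mul, Nat.cast_succ, mul_comm ((i : K) + 1), mul_assoc,
      mul_comm ((i : K) + 1)]
    exact ⟨hi.1, fun hn => (mul_eq_zero.mp (hi.2 (by omega))).resolve_right
      (Nat.cast_add_one_ne_zero i)⟩

theorem norm_eval_le_of_mem_dividedPowerBall (ha : a ∈ dividedPowerBall K n r) {B : ℝ}
    (hB : 1 ≤ B) (hfactorial : ∀ i : ℕ, ‖((i)! : K)‖⁻¹ ≤ B ^ i) (t : K) :
    ‖a.eval t‖ ≤ r * (B * max 1 ‖t‖) ^ n := by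
  rw [Polynomial.eval_eq_sum, Polynomial.sum_def]
  refine IsUltrametricDist.norm_sum_le_of_forall_le_of_nonneg (by positivity) fun i hi => ?_
  have hin : i ≤ n := not_lt.mp fun hi' => Polynomial.mem_support_iff.mp hi ((ha i).2 hi')
  have hcoeff : ‖a.coeff i‖ ≤ r * ‖((i)! : K)‖⁻¹ := by
    rw [le_mul_inv_iff₀ (norm_factorial_pos i), mul_comm, ← norm_mul]
    exact (ha i).1
  rw [norm_mul, norm_pow]
  calc ‖a.coeff i‖ * ‖t‖ ^ i ≤ r * B ^ i * max 1 ‖t‖ ^ i := by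
        gcongr
        · exact hcoeff.trans (mul_le_mul_of_nonneg_left (hfactorial i) r.2)
        · exact le_max_right _ _
    _ = r * (B * max 1 ‖t‖) ^ i := by rw [mul_pow, mul_assoc]
    _ ≤ r * (B * max 1 ‖t‖) ^ n := by
        gcongr
        exact one_le_mul_of_one_le_of_one_le hB (le_max_left _ _)

theorem coeff_succ_flow_mem_dividedPowerBall {V : K⟦X⟧} (hV : X ^ 2 ∣ V)
    (hVr : ∀ n, ‖coeff (n + 1) V‖ ≤ (r : ℝ) ^ n) (n : ℕ) :
    coeff (n + 1) (flow V) ∈ dividedPowerBall K n (r ^ n) := by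
  obtain ⟨-, hzero, hflow⟩ := isFormalFlow_flow hV
  obtain ⟨w, hw⟩ := dvd_flow hV
  induction n using Nat.strong_induction_on with
  | _ n ih =>
  obtain _ | n := n
  · rw [coeff_eq_of_X_pow_dvd_sub (X_pow_dvd_flow_sub_X one_ne_zero hV) (by omega), zero_add,
      coeff_one_X, pow_zero]
    exact one_mem_dividedPowerBall
  have hw_mem (i : ℕ) (hi : i ≤ n) : coeff i w ∈ dividedPowerBall K i (r ^ i) := by
    simpa only [hw, coeff_succ_X_mul] using ih i (by omega)
  refine mem_dividedPowerBall_of_derivative_mem ?_ ?_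
  · rw [Polynomial.coeff_zero_eq_eval_zero, ← Polynomial.coe_evalRingHom, ← coeff_map, hzero,
      coeff_X, if_neg (by omega)]
  rw [← coeff_mk (n + 1 + 1) fun k => Polynomial.derivative (coeff k (flow V)), ← timeDeriv, hflow,
    coeff_subst_eq_sum V (dvd_flow hV) (Nat.lt_succ_self _)]
  refine sum_mem fun d hd => ?_
  have hdn := Finset.mem_range.mp hd
  obtain hd2 | hd2 := lt_or_ge d 2
  · rw [X_pow_dvd_iff.mp hV d hd2, zero_smul]
    exact zero_mem _
  obtain ⟨e, rfl⟩ : ∃ e, d = e + 2 := ⟨d - 2, by omega⟩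
  rw [hw, coeff_X_mul_pow w (by omega)]
  have hpow := coeff_pow_mem_of_forall_le (fun n => dividedPowerBall K n (r ^ n))
    (fun i hi => hw_mem i (by omega)) (e + 2) (n := n + 1 + 1 - (e + 2))
  have hterm := smul_mem_dividedPowerBall (s := r ^ (e + 1)) (by exact_mod_cast hVr (e + 1)) hpow
  rw [← pow_add, show e + 1 + (n + 1 + 1 - (e + 2)) = n + 1 by omega] at hterm
  exact dividedPowerBall_mono (by omega) hterm

end NormedField

variable {K : Type*} [NontriviallyNormedField K] [IsUltrametricDist K]

theorem isLocallyAnalytic_timeMap [CharZero K] {V : K⟦X⟧} (hV : X ^ 2 ∣ V)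
    (hVa : IsLocallyAnalytic V) (t : K) : IsLocallyAnalytic (timeMap V t) := by
  obtain ⟨R, hR, hVR⟩ := hVa.exists_norm_coeff_succ_le_pow (by
    rw [X_pow_dvd_iff.mp hV 1 (by omega), norm_zero]
    exact zero_le_one)
  obtain ⟨B, hB, hfactorial⟩ := exists_inv_norm_factorial_le (K := K)
  lift R to ℝ≥0 using zero_le_one.trans hR
  refine isLocallyAnalytic_of_norm_coeff_succ_le (B := 1) (r := R * (B * max 1 ‖t‖))
    (by positivity) fun n => ?_
  rw [timeMap, coeff_map, Polynomial.coe_evalRingHom, one_mul, mul_pow, ← NNReal.coe_pow]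
  exact norm_eval_le_of_mem_dividedPowerBall
    (coeff_succ_flow_mem_dividedPowerBall hV hVR n) hB hfactorial t

theorem isLocallyAnalytic_modelField {m : ℕ} (hm : 2 ≤ m) (μ : K) :
    IsLocallyAnalytic (modelField m μ) := by
  set ν := μ - (m : K) / 2 with hν
  have hdenom (n : ℕ) : ‖coeff n (1 - C ν * X ^ (m - 1) : K⟦X⟧)‖ ≤ max 1 ‖ν‖ ^ n := by
    rw [map_sub, coeff_one, coeff_C_mul, coeff_X_pow]
    obtain rfl | hn := eq_or_ne n 0
    · rw [if_pos rfl, if_neg (by omega), mul_zero, sub_zero, norm_one, pow_zero]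
    rw [if_neg hn, zero_sub, norm_neg, mul_ite, mul_one, mul_zero]
    split_ifs
    · exact (le_max_right _ _).trans (le_self_pow₀ (le_max_left _ _) hn)
    · rw [norm_zero]
      positivity
  have hconst : constantCoeff (1 - C ν * X ^ (m - 1) : K⟦X⟧) = 1 := by
    simp [show m - 1 ≠ 0 by omega]
  refine isLocallyAnalytic_of_norm_coeff_le (B := 1) (r := max 1 ‖ν‖) (by positivity) fun n => ?_
  rw [modelField, ← hν, coeff_X_pow_mul', one_mul]
  split_ifs
  · exact (norm_coeff_inv_le hconst hdenom _).trans
      (pow_le_pow_right₀ (le_max_left _ _) (Nat.sub_le _ _))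
  · rw [norm_zero]
    positivity

end FlowConvergence

section Centralizers

variable {K : Type*} [NontriviallyNormedField K] [IsUltrametricDist K] [CharZero K]

theorem formalCentralizer_eq_analyticCentralizer {f : K⟦X⟧} {q : ℕ} (hq : q ≠ 0)
    (hfa : IsLocallyAnalytic f) (hf : X ^ (q + 1) ∣ f - X) (hf0 : coeff (q + 1) f ≠ 0) :
    formalCentralizer f = analyticCentralizer f := by
  refine Set.Subset.antisymm (fun g ⟨hg, hcomm⟩ => ⟨?_, hg, hcomm⟩) fun g hg => hg.2
  exact isLocallyAnalytic_of_comp_eq_comp hq hfa hfa (X_dvd_of_X_pow_dvd_sub_X hf) hf hf0 hg.X_dvd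
    (hg.2 ▸ one_ne_zero) hcomm

theorem centralizers_eq_of_comp_timeMap {V f h : K⟦X⟧} {q : ℕ} (hq : q ≠ 0)
    (hV : X ^ (q + 1) ∣ V) (hV0 : coeff (q + 1) V ≠ 0) (hfa : IsLocallyAnalytic f) (hf : X ∣ f)
    (hh : X ∣ h) (h1 : coeff 1 h ≠ 0) (hcomp : comp h f = comp (timeMap V 1) h) :
    analyticCentralizer f = {g | ∃ t : K, g = comp (compInv h h1) (comp (timeMap V t) h)} ∧
      formalCentralizer f = analyticCentralizer f := by
  have hT := X_pow_dvd_timeMap_sub_X hq hV 1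
  have hf0 : coeff (q + 1) f ≠ 0 := by
    rw [coeff_succ_of_comp_eq_comp hq hf hT hh h1 hcomp, coeff_succ_timeMap hq hV, mul_one]
    exact mul_ne_zero (pow_ne_zero q h1) hV0
  have hZ := formalCentralizer_eq_analyticCentralizer hq hfa
    (X_pow_dvd_sub_X_of_comp_eq_comp hf hT hh h1 hcomp) hf0
  exact ⟨hZ ▸ formalCentralizer_eq_of_comp_timeMap hq hV hV0 hf hh h1 hcomp, hZ⟩

end Centralizers

end NonArchGerm

open NonArchGerm in
theorem mainTheorem4_general {K : Type*} [NontriviallyNormedField K] [IsUltrametricDist K]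
    [CharZero K] (f : K⟦X⟧) (hf : IsLocallyAnalytic f) (hf1 : TangentToId f) (m : ℕ) (μ : K)
    (hinv : HasInvariants f m μ) :
    (∃ (h : K⟦X⟧) (h1 : coeff 1 h ≠ 0),
      IsLocallyAnalytic h ∧ constantCoeff h = 0 ∧ (coeff m f = 1 → TangentToId h) ∧
      conj h h1 f = timeMap (modelField m μ) 1) ∧
    ∀ (h : K⟦X⟧) (h1 : coeff 1 h ≠ 0), constantCoeff h = 0 →
      conj h h1 f = timeMap (modelField m μ) 1 →
      analyticCentralizer f =
        {g | ∃ t : K, g = comp (compInv h h1) (comp (timeMap (modelField m μ) t) h)} ∧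
      formalCentralizer f = analyticCentralizer f := by
  have hm := hinv.1
  obtain ⟨q, rfl⟩ : ∃ q, m = q + 1 := ⟨m - 1, by omega⟩
  have hq : q ≠ 0 := by omega
  have hV := X_pow_dvd_modelField (q + 1) μ
  have hV0 : coeff (q + 1) (modelField (q + 1) μ) ≠ 0 :=
    coeff_succ_modelField hq μ ▸ one_ne_zero
  have hT := X_pow_dvd_timeMap_sub_X hq hV 1
  have hTX := X_dvd_of_X_pow_dvd_sub_X hT
  refine ⟨?_, fun h h1 h0 hconj => ?_⟩
  · obtain ⟨h, hh, h1, htangent, hcomp⟩ := exists_comp_eq_comp_timeMap hf1 hinv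
    have hTa := isLocallyAnalytic_timeMap (X_sq_dvd_modelField hm μ)
      (isLocallyAnalytic_modelField hm μ) 1
    have hT0 : coeff (q + 1) (timeMap (modelField (q + 1) μ) 1) ≠ 0 := by
      rwa [coeff_succ_timeMap hq hV, mul_one]
    have hha := isLocallyAnalytic_of_comp_eq_comp hq hf hTa hf1.X_dvd hT hT0 hh h1 hcomp
    exact ⟨h, h1, hha, X_dvd_iff.mp hh, fun hfm => ⟨X_dvd_iff.mp hh, htangent hfm⟩,
      (conj_eq_iff hh h1 hf1.X_dvd hTX).mpr hcomp⟩
  · have hh := X_dvd_iff.mpr h0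
    exact centralizers_eq_of_comp_timeMap hq hV hV0 hf hf1.X_dvd hh h1
      ((conj_eq_iff hh h1 hf1.X_dvd hTX).mp hconj)

theorem mainTheorem4 {K : Type*} [NontriviallyNormedField K] [IsUltrametricDist K]
    [CompleteSpace K] [CharZero K] (f : PowerSeries K) (hf : NonArchGerm.IsLocallyAnalytic f)
    (hf1 : NonArchGerm.TangentToId f) (m : ℕ) (μ : K) (hinv : NonArchGerm.HasInvariants f m μ) :
    (∃ (h : PowerSeries K) (h1 : PowerSeries.coeff 1 h ≠ 0),
      NonArchGerm.IsLocallyAnalytic h ∧ PowerSeries.constantCoeff h = 0 ∧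
      (PowerSeries.coeff m f = 1 → NonArchGerm.TangentToId h) ∧
      NonArchGerm.conj h h1 f = NonArchGerm.timeMap (NonArchGerm.modelField m μ) 1) ∧
    ∀ (h : PowerSeries K) (h1 : PowerSeries.coeff 1 h ≠ 0),
      NonArchGerm.IsLocallyAnalytic h → PowerSeries.constantCoeff h = 0 →
      NonArchGerm.conj h h1 f = NonArchGerm.timeMap (NonArchGerm.modelField m μ) 1 →
      NonArchGerm.analyticCentralizer f =
        {g | ∃ t : K, g = NonArchGerm.comp (NonArchGerm.compInv h h1)
          (NonArchGerm.comp (NonArchGerm.timeMap (NonArchGerm.modelField m μ) t) h)} ∧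
      NonArchGerm.formalCentralizer f = NonArchGerm.analyticCentralizer f := by
  obtain ⟨hexists, hcentralizers⟩ := mainTheorem4_general f hf hf1 m μ hinv
  exact ⟨hexists, fun h h1 _ => hcentralizers h h1⟩
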